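/- Let $\mathcal V,\mathcal X$ be finite-dimensional real normed spaces ($\mathcal V$ Euclidean), $\alpha\in(1/3,1/2]$, and let $\mathbf W=(W,\mathbb W)$ be an $\alpha$-Hölder rough path on $[0,1]$ with values in $\mathcal V$, i.e. $W\in C^{\alpha}([0,1];\mathcal V)$, $|\mathbb W_{s,t}|\le C|t-s|^{2\alpha}$ with $\mathbb W_{s,t}\in \mathcal V\otimes\mathcal V$, and $\mathbb W_{s,t}-\mathbb W_{s,u}-\mathbb W_{u,t}=(W_u-W_s)\otimes(W_t-W_u)$ for all $s,u,t\in[0,1]$. Let $D^{2\alpha}_W([0,1];\mathcal X)$ be the space of controlled rough paths, i.e. of pairs $(Y,Y')$ with $Y\in C^\alpha([0,1];\mathcal X)$, $Y'\in C^\alpha([0,1];\mathcal L(\mathcal V,\mathcal X))$ and $|R^Y_{s,t}|\le C|t-s|^{2\alpha}$, where $R^Y_{s,t}=Y_t-Y_s-Y'_s(W_t-W_s)$. Let $\|\cdot\|_{\mathbf D^{2\alpha}_W}$ be either of the two equivalent norms $$|Y_0|+|Y'_0|+\|Y'\|_\alpha+\|R^Y\|_{2\alpha}\qquad\text{or}\qquad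 \|Y\|_\infty+\|Y'\|_\infty+\|Y'\|_\alpha+\|R^Y\|_{2\alpha}$$ ($\|\cdot\|_\alpha,\|\cdot\|_{2\alpha}$ the Hölder semi-norms). Let $A\in\mathcal L(\mathcal X)$ and $S(t)=e^{tA}$. Let $F:\mathcal X\to\mathcal X$ be $C^1$ with bounded derivative and $F(0)=DF(0)=0$, and let $G:\mathcal X\to\mathcal L(\mathcal V,\mathcal X)$ be $C^3$ with bounded derivatives of orders $1,2,3$ and $G(0)=DG(0)=D^2G(0)=0$. Let $f:[0,\infty)\to[0,1]$ be a $C^3$ function with $f=1$ on $[0,1/2]$ and $f=0$ on $[1,\infty)$. For $R>0$ and $(Y,Y')\in D^{2\alpha}_W([0,1];\mathcal X)$ put $\rho=f(\|Y,Y'\|_{\mathbf D^{2\alpha}_W}/R)$ and $$\chi_R(Y)=\rho\,Y,\quad (\chi_R(Y))'=\rho\,Y',\quad F_R(Y)(t)=F(\chi_R(Y)_t),\quad G_R(Y)(t)=G(\chi_R(Y)_t),$$ where $G_R(Y)$ has Gubinelli derivative $DG(\chi_R(Y))(\chi_R(Y))'$, and $$T_R(Y,Y')=\Big(\int_0^{\cdot}S(\cdot-r)F_R(Y)(r)\,dr+\int_0^{\cdot}S(\cdot-r)G_R(Y)(r)\,d\mathbf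 W_r,\; G_R(Y)\Big).$$ Here, for a controlled rough path $(Z,Z')\in D^{2\alpha}_W([0,1];\mathcal L(\mathcal V,\mathcal X))$, $\int_s^tZ_r\,d\mathbf W_r$ is the limit of $\sum_{[u,v]\in\mathcal P}\big(Z_u(W_v-W_u)+Z'_u\mathbb W_{u,v}\big)$ over partitions $\mathcal P$ of $[s,t]$ with mesh $|\mathcal P|\to0$, and $r\mapsto S(t-r)G_R(Y)(r)$ has Gubinelli derivative $S(t-r)(G_R(Y))'(r)$. Then: 1. For every $R>0$ and every $(Y,Y')\in D^{2\alpha}_W([0,1];\mathcal X)$, the drift integrands are integrable, for every $t\in[0,1]$ the pair $\big(S(t-\cdot)G_R(Y),S(t-\cdot)(G_R(Y))'\big)$ belongs to $D^{2\alpha}_W([0,1];\mathcal L(\mathcal V,\mathcal X))$ and its rough integral over $[0,t]$ exists, and $T_R(Y,Y')\in D^{2\alpha}_W([0,1];\mathcal X)$. 2. There is $R_0>0$ such that for every $R\in(0,R_0]$: (a) $T_R$ is a contraction on $D^{2\alpha}_W([0,1];\mathcal X)$: there is $K\in[0,1)$ with $\|T_R(Y,Y')-T_R(\widetilde Y,\widetilde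 Y')\|_{\mathbf D^{2\alpha}_W}\le K\|Y-\widetilde Y,Y'-\widetilde Y'\|_{\mathbf D^{2\alpha}_W}$ for all $(Y,Y'),(\widetilde Y,\widetilde Y')\in D^{2\alpha}_W([0,1];\mathcal X)$; (b) $T_R$ has a unique fixed point in $D^{2\alpha}_W([0,1];\mathcal X)$; (c) for every $\xi\in\mathcal X$ the truncated rough differential equation with initial value $\xi$ has a unique mild solution, i.e. there is a unique $(U,U')\in D^{2\alpha}_W([0,1];\mathcal X)$ with $(U,U')=(S(\cdot)\xi,0)+T_R(U,U')$. -/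

import Mathlib

open scoped NNReal TensorProduct unitInterval

noncomputable section

namespace RoughCutoff

section Spaces

variable {V X : Type*}
  [NormedAddCommGroup V] [InnerProductSpace ℝ V]
  [NormedAddCommGroup X] [NormedSpace ℝ X]

/-- `‖Ξ s t‖ ≤ C |t - s| ^ β` on `[0,1]²` for some constant `C`. -/
def MemHolderTwo {E : Type*} [NormedAddCommGroup E] (β : ℝ) (Ξ : I → I → E) : Prop :=
  ∃ C : ℝ, ∀ s t : I, ‖Ξ s t‖ ≤ C * |(t : ℝ) - s| ^ β

/-- The two-parameter Hölder semi-norm `sup_{s ≠ t} ‖Ξ s t‖ / |t - s| ^ β`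
(the diagonal contributes `0`). -/
def holderTwo {E : Type*} [NormedAddCommGroup E] (β : ℝ) (Ξ : I → I → E) : ℝ :=
  ⨆ p : I × I, ‖Ξ p.1 p.2‖ / |(p.2 : ℝ) - p.1| ^ β

/-- An `α`-Hölder rough path `(W, 𝕎)` over `[0,1]` with values in `V`. -/
structure RoughPath (α : ℝ≥0) (V : Type*) [NormedAddCommGroup V] [InnerProductSpace ℝ V] where
  /-- the path `W` -/
  path : I → V
  /-- the second order process `𝕎` -/
  area : I → I → V ⊗[ℝ] V
  path_holder : MemHolder α path
  area_holder : MemHolderTwo (2 * α) area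
  /-- Chen's relation -/
  chen : ∀ s u t : I,
    area s t - area s u - area u t = (path u - path s) ⊗ₜ[ℝ] (path t - path u)

/-- Pairs `(Y, Y')` of a path in `X` and a path in `L(V, X)`. -/
abbrev PathPair (V X : Type*) [NormedAddCommGroup V] [InnerProductSpace ℝ V]
    [NormedAddCommGroup X] [NormedSpace ℝ X] : Type _ :=
  (I → X) × (I → V →L[ℝ] X)

/-- The remainder `R^Y_{s,t} = Y_t - Y_s - Y'_s (W_t - W_s)`. -/
def remainder (W : I → V) (Y : PathPair V X) (s t : I) : X :=
  Y.1 t - Y.1 s - Y.2 s (W t - W s)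

/-- The space `D^{2α}_W([0,1]; X)` of controlled rough paths `(Y, Y')`. -/
def controlled (α : ℝ≥0) (W : I → V) : Set (PathPair V X) :=
  {Y | MemHolder α Y.1 ∧ MemHolder α Y.2 ∧ MemHolderTwo (2 * α) (remainder W Y)}

/-- The semi-norm `‖Y'‖_α + ‖R^Y‖_{2α}`. -/
def crpSeminorm (α : ℝ≥0) (W : I → V) (Y : PathPair V X) : ℝ :=
  nnHolderNorm α Y.2 + holderTwo (2 * α) (remainder W Y)

/-- The norm `|Y_0| + |Y'_0| + ‖Y'‖_α + ‖R^Y‖_{2α}`. -/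
def crpNorm (α : ℝ≥0) (W : I → V) (Y : PathPair V X) : ℝ :=
  ‖Y.1 0‖ + ‖Y.2 0‖ + crpSeminorm α W Y

/-- The norm `‖Y‖_∞ + ‖Y'‖_∞ + ‖Y'‖_α + ‖R^Y‖_{2α}`. -/
def crpSupNorm (α : ℝ≥0) (W : I → V) (Y : PathPair V X) : ℝ :=
  (⨆ t : I, ‖Y.1 t‖) + (⨆ t : I, ‖Y.2 t‖) + crpSeminorm α W Y

end Spaces

section Integral

variable {V X : Type*}
  [NormedAddCommGroup V] [InnerProductSpace ℝ V]
  [NormedAddCommGroup X] [NormedSpace ℝ X]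

/-- A map in `L(V, L(V, X))` applied to a tensor: `B (v ⊗ w) = B v w`. -/
def applyTensor (B : V →L[ℝ] V →L[ℝ] X) : V ⊗[ℝ] V →ₗ[ℝ] X :=
  TensorProduct.lift ((ContinuousLinearMap.coeLM ℝ).comp (B : V →ₗ[ℝ] V →L[ℝ] X))

/-- A partition `s = t_0 < t_1 < ⋯ < t_n = t` of `[s,t] ⊆ [0,1]`. -/
structure Partition (s t : I) where
  n : ℕ
  pt : Fin (n + 1) → I
  strictMono : StrictMono pt
  pt_zero : pt 0 = s
  pt_last : pt (Fin.last n) = t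

/-- The compensated Riemann sum `∑ (Y_u W_{u,v} + Y'_u 𝕎_{u,v})` over the intervals `[u,v]` of
a partition. -/
def compensatedSum {α : ℝ≥0} (W : RoughPath α V) (Y : PathPair V (V →L[ℝ] X)) {s t : I}
    (P : Partition s t) : X :=
  ∑ i : Fin P.n,
    (Y.1 (P.pt i.castSucc) (W.path (P.pt i.succ) - W.path (P.pt i.castSucc)) +
      applyTensor (Y.2 (P.pt i.castSucc)) (W.area (P.pt i.castSucc) (P.pt i.succ)))

/-- `J` is the limit of the compensated Riemann sums over partitions of `[s,t]` as the mesh tends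
to `0`. -/
def IsRoughIntegral {α : ℝ≥0} (W : RoughPath α V) (Y : PathPair V (V →L[ℝ] X)) (s t : I)
    (J : X) : Prop :=
  ∀ ε : ℝ, 0 < ε → ∃ δ : ℝ, 0 < δ ∧ ∀ P : Partition s t,
    (∀ i : Fin P.n, (P.pt i.succ : ℝ) - P.pt i.castSucc < δ) → ‖compensatedSum W Y P - J‖ < ε

open Classical in
/-- The rough integral `∫_s^t Y_r d𝐖_r` (for `s ≤ t`); `0` if the limit does not exist. -/
def roughIntegral {α : ℝ≥0} (W : RoughPath α V) (Y : PathPair V (V →L[ℝ] X)) (s t : I) : X :=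
  if h : ∃ J, IsRoughIntegral W Y s t J then h.choose else 0

end Integral

section Equation

variable {V X : Type*}
  [NormedAddCommGroup V] [InnerProductSpace ℝ V]
  [NormedAddCommGroup X] [NormedSpace ℝ X]

/-- The group `S(t) = exp(tA)`. -/
def sg (A : X →L[ℝ] X) (t : ℝ) : X →L[ℝ] X := NormedSpace.exp (t • A)

/-- `m`-times continuously differentiable maps whose derivatives of order `1, …, m` are bounded
(boundedness of the map itself is not required). -/
def BoundedDerivs {E E' : Type*} [NormedAddCommGroup E] [NormedSpace ℝ E]
    [NormedAddCommGroup E'] [NormedSpace ℝ E'] (m : ℕ) (H : E → E') : Prop :=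
  ContDiff ℝ m H ∧ ∀ k : ℕ, 1 ≤ k → k ≤ m → ∃ C : ℝ, ∀ x, ‖iteratedFDeriv ℝ k H x‖ ≤ C

/-- `f : [0,∞) → [0,1]` is `C³`, equals `1` on `[0,1/2]` and `0` on `[1,∞)`. Such an `f` is
Lipschitz with bounded derivatives, since it is constant off a compact interval. Values at
negative arguments play no role. -/
structure IsCutoff (f : ℝ → ℝ) : Prop where
  contDiffOn : ContDiffOn ℝ 3 f (Set.Ici 0)
  mem_Icc : ∀ x, 0 ≤ x → f x ∈ Set.Icc (0 : ℝ) 1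
  eq_one : ∀ x, 0 ≤ x → x ≤ 1 / 2 → f x = 1
  eq_zero : ∀ x, 1 ≤ x → f x = 0

/-- The cut-off `χ_R(Y, Y') = (Y f(N(Y,Y')/R), Y' f(N(Y,Y')/R))` at the level of paths, for a norm
`N` on controlled rough paths. -/
def cutoff (N : PathPair V X → ℝ) (f : ℝ → ℝ) (R : ℝ) (Y : PathPair V X) : PathPair V X :=
  f (N Y / R) • Y

/-- The composition `(G(Y), DG(Y) Y')`. -/
def compose (G : X → V →L[ℝ] X) (Y : PathPair V X) : PathPair V (V →L[ℝ] X) :=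
  (fun t => G (Y.1 t), fun t => (fderiv ℝ G (Y.1 t)).comp (Y.2 t))

/-- The pair `(S(t-·) Z, S(t-·) Z')`. -/
def shifted (A : X →L[ℝ] X) (t : I) (Z : PathPair V (V →L[ℝ] X)) : PathPair V (V →L[ℝ] X) :=
  (fun r => (sg A ((t : ℝ) - r)).comp (Z.1 r),
   fun r => (ContinuousLinearMap.compL ℝ V X X (sg A ((t : ℝ) - r))).comp (Z.2 r))

/-- The integrand `r ↦ S(t-r) F(Y_r)`, where `Y` is extended from `[0,1]` to `ℝ` by constants. -/
def driftIntegrand (A : X →L[ℝ] X) (F : X → X) (Y : I → X) (t : I) (r : ℝ) : X :=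
  sg A ((t : ℝ) - r) (F (Y (Set.projIcc 0 1 zero_le_one r)))

/-- The drift convolution `∫_0^t S(t-r) F(Y_r) dr`. -/
def driftConv (A : X →L[ℝ] X) (F : X → X) (Y : I → X) (t : I) : X :=
  ∫ r in (0 : ℝ)..t, driftIntegrand A F Y t r

/-- The rough convolution `∫_0^t S(t-r) Z_r d𝐖_r`. -/
def roughConv {α : ℝ≥0} (W : RoughPath α V) (A : X →L[ℝ] X) (Z : PathPair V (V →L[ℝ] X))
    (t : I) : X :=
  roughIntegral W (shifted A t Z) 0 t

/-- The map
`T_R(Y,Y') = (∫_0^· S(·-r) F(χ_R(Y)_r) dr + ∫_0^· S(·-r) G(χ_R(Y)_r) d𝐖_r, G(χ_R(Y)))`. -/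
def mildMap {α : ℝ≥0} (W : RoughPath α V) (A : X →L[ℝ] X) (F : X → X) (G : X → V →L[ℝ] X)
    (N : PathPair V X → ℝ) (f : ℝ → ℝ) (R : ℝ) (Y : PathPair V X) : PathPair V X :=
  (fun t => driftConv A F (cutoff N f R Y).1 t + roughConv W A (compose G (cutoff N f R Y)) t,
   (compose G (cutoff N f R Y)).1)

/-- The pair `(S(·)ξ, 0)`. -/
def initialPair (A : X →L[ℝ] X) (ξ : X) : PathPair V X := (fun t => sg A t ξ, 0)

end Equation

end RoughCutoff

end

/-! The time interval is fixed, so the contraction comes from small amplitude and not from short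
time. After the cut-off every path entering `F` and `G` has norm at most R, and the cut-off is
Lipschitz with a constant independent of R (`IsCtrlNorm.cutoff_sub_le`): the factor 1/R from
differentiating f(·/R) only matters where it multiplies a path of norm at most R.

On paths of size R the nonlinearities have small Lipschitz constants. For `F` this is continuity of
DF together with DF(0) = 0 (`exists_lipschitz_near_zero`). For `G`, a bounded third derivative and
vanishing up to order two at 0 give DG = O(R²) and D²G = O(R), whence composition with `G` is
Lipschitz on controlled paths with constant O(R²) (`CubicAtZero.ctrlBound_composePair_sub`).

What remains is linear: drift and rough convolution are bounded maps into controlled paths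
(`exists_convPair_bound`). The rough integral comes from the sewing lemma
(`AlmostAdditive.exists_path`), applicable because 3α > 1. Since A is bounded, S is a group and
S(t-r) = S(t)S(-r), so a convolution is an ordinary integral multiplied by a path of operators that
is Lipschitz in time.

Both norms enter only through `IsCtrlNorm`, which trades a norm for the pointwise bounds `CtrlBound`
and back. The space is complete, so Banach's theorem gives the fixed points; an initial value adds a
constant pair, which cancels in differences. -/

noncomputable section

namespace RoughCutoff

/-! ### Hölder bounds and the two norms on controlled paths. -/

section Norms

variable {V X E : Type*}
  [NormedAddCommGroup V] [InnerProductSpace ℝ V]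
  [NormedAddCommGroup X] [NormedSpace ℝ X] [NormedAddCommGroup E]

lemma abs_sub_le_one (s t : I) : |(t : ℝ) - s| ≤ 1 := by
  rw [abs_le]; constructor <;> linarith [s.2.1, s.2.2, t.2.1, t.2.2]

lemma abs_sub_rpow_le_one (s t : I) {β : ℝ} (hβ : 0 ≤ β) : |(t : ℝ) - s| ^ β ≤ 1 :=
  Real.rpow_le_one (abs_nonneg _) (abs_sub_le_one s t) hβ

lemma holderWith_iff {α C : ℝ≥0} {f : I → E} :
    HolderWith C α f ↔ ∀ s t : I, ‖f t - f s‖ ≤ C * |(t : ℝ) - s| ^ (α : ℝ) := by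
  constructor
  · intro h s t
    have := h.dist_le t s
    rwa [dist_eq_norm, Subtype.dist_eq, Real.dist_eq] at this
  · intro h s t
    have := h t s
    rw [← dist_eq_norm, ← Real.dist_eq, ← Subtype.dist_eq, dist_nndist, dist_nndist] at this
    rw [edist_nndist, edist_nndist, ← ENNReal.coe_rpow_of_nonneg _ α.coe_nonneg, ← ENNReal.coe_mul,
      ENNReal.coe_le_coe]
    exact_mod_cast this

lemma memHolder_of_bound {α : ℝ≥0} {f : I → E} {C : ℝ}
    (h : ∀ s t : I, ‖f t - f s‖ ≤ C * |(t : ℝ) - s| ^ (α : ℝ)) : MemHolder α f := by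
  refine ⟨C.toNNReal, holderWith_iff.2 fun s t => (h s t).trans ?_⟩
  gcongr
  exact Real.le_coe_toNNReal C

lemma nnHolderNorm_le_of_bound {α : ℝ≥0} {f : I → E} {C : ℝ} (hC : 0 ≤ C)
    (h : ∀ s t : I, ‖f t - f s‖ ≤ C * |(t : ℝ) - s| ^ (α : ℝ)) : (nnHolderNorm α f : ℝ) ≤ C := by
  lift C to ℝ≥0 using hC
  exact_mod_cast (holderWith_iff.2 h).nnholderNorm_le

lemma norm_sub_le_nnHolderNorm {α : ℝ≥0} {f : I → E} (hf : MemHolder α f) (s t : I) :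
    ‖f t - f s‖ ≤ nnHolderNorm α f * |(t : ℝ) - s| ^ (α : ℝ) :=
  holderWith_iff.1 hf.holderWith s t

lemma bddAbove_holderTwo {β : ℝ} {Ξ : I → I → E} (h : MemHolderTwo β Ξ) :
    BddAbove (Set.range fun p : I × I => ‖Ξ p.1 p.2‖ / |(p.2 : ℝ) - p.1| ^ β) := by
  obtain ⟨C, hC⟩ := h
  refine ⟨max C 0, ?_⟩
  rintro _ ⟨p, rfl⟩
  refine div_le_of_le_mul₀ (by positivity) (le_max_right _ _) ((hC _ _).trans ?_)
  gcongr
  exact le_max_left _ _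

lemma holderTwo_nonneg (β : ℝ) (Ξ : I → I → E) : 0 ≤ holderTwo β Ξ :=
  Real.iSup_nonneg fun _ => by positivity

lemma holderTwo_le_of_bound {β : ℝ} {Ξ : I → I → E} {C : ℝ} (hC : 0 ≤ C)
    (h : ∀ s t : I, ‖Ξ s t‖ ≤ C * |(t : ℝ) - s| ^ β) : holderTwo β Ξ ≤ C :=
  ciSup_le fun p => div_le_of_le_mul₀ (by positivity) hC (h p.1 p.2)

lemma norm_le_holderTwo {β : ℝ} (hβ : β ≠ 0) {Ξ : I → I → E} (h : MemHolderTwo β Ξ) (s t : I) :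
    ‖Ξ s t‖ ≤ holderTwo β Ξ * |(t : ℝ) - s| ^ β := by
  rcases eq_or_ne s t with rfl | hst
  -- On the diagonal the quotient in `holderTwo` carries no information; there 0 ^ β = 0 forces Ξ s
  -- s = 0.
  · obtain ⟨C, hC⟩ := h
    simpa [Real.zero_rpow hβ] using hC s s
  · have : 0 < |(t : ℝ) - s| := abs_pos.2 (sub_ne_zero.2 fun h => hst (Subtype.ext h.symm))
    rw [← div_le_iff₀ (by positivity)]
    exact le_ciSup (bddAbove_holderTwo h) (s, t)

/-- Pointwise bounds, by one constant, for all the quantities in the norms of a controlled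
path. -/
structure CtrlBound (α : ℝ≥0) (W : I → V) (Y : PathPair V X) (M : ℝ) : Prop where
  path : ∀ t, ‖Y.1 t‖ ≤ M
  deriv : ∀ t, ‖Y.2 t‖ ≤ M
  deriv_holder : ∀ s t : I, ‖Y.2 t - Y.2 s‖ ≤ M * |(t : ℝ) - s| ^ (α : ℝ)
  rem : ∀ s t : I, ‖remainder W Y s t‖ ≤ M * |(t : ℝ) - s| ^ (2 * (α : ℝ))

lemma remainder_add (W : I → V) (Y Z : PathPair V X) (s t : I) :
    remainder W (Y + Z) s t = remainder W Y s t + remainder W Z s t := by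
  simp [remainder]; abel

lemma remainder_smul (W : I → V) (c : ℝ) (Y : PathPair V X) (s t : I) :
    remainder W (c • Y) s t = c • remainder W Y s t := by
  simp [remainder, smul_sub]

lemma remainder_sub (W : I → V) (Y Z : PathPair V X) (s t : I) :
    remainder W (Y - Z) s t = remainder W Y s t - remainder W Z s t := by
  simp [remainder]; abel

lemma norm_sub_eq_remainder (W : I → V) (Y : PathPair V X) (s t : I) :
    Y.1 t - Y.1 s = Y.2 s (W t - W s) + remainder W Y s t := by
  simp [remainder]

namespace CtrlBound

variable {α : ℝ≥0} {W : I → V} {Y Z : PathPair V X} {M M' : ℝ}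

lemma nonneg (h : CtrlBound α W Y M) : 0 ≤ M := (norm_nonneg _).trans (h.path 0)

lemma mono (h : CtrlBound α W Y M) (hM : M ≤ M') : CtrlBound α W Y M' where
  path t := (h.path t).trans hM
  deriv t := (h.deriv t).trans hM
  deriv_holder s t := (h.deriv_holder s t).trans (by gcongr)
  rem s t := (h.rem s t).trans (by gcongr)

lemma add (hY : CtrlBound α W Y M) (hZ : CtrlBound α W Z M') :
    CtrlBound α W (Y + Z) (M + M') where
  path t := norm_add_le_of_le (hY.path t) (hZ.path t)
  deriv t := norm_add_le_of_le (hY.deriv t) (hZ.deriv t)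
  deriv_holder s t := by
    rw [add_mul]
    have : (Y + Z).2 t - (Y + Z).2 s = (Y.2 t - Y.2 s) + (Z.2 t - Z.2 s) := by simp; abel
    rw [this]
    exact norm_add_le_of_le (hY.deriv_holder s t) (hZ.deriv_holder s t)
  rem s t := by
    rw [add_mul, remainder_add]
    exact norm_add_le_of_le (hY.rem s t) (hZ.rem s t)

lemma smul (c : ℝ) (hY : CtrlBound α W Y M) : CtrlBound α W (c • Y) (|c| * M) where
  path t := by
    simpa [norm_smul] using mul_le_mul_of_nonneg_left (hY.path t) (abs_nonneg c)
  deriv t := by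
    simpa [norm_smul] using mul_le_mul_of_nonneg_left (hY.deriv t) (abs_nonneg c)
  deriv_holder s t := by
    have : (c • Y).2 t - (c • Y).2 s = c • (Y.2 t - Y.2 s) := by simp [smul_sub]
    rw [this, norm_smul, mul_assoc]
    exact mul_le_mul_of_nonneg_left (hY.deriv_holder s t) (abs_nonneg c)
  rem s t := by
    rw [remainder_smul, norm_smul, mul_assoc]
    exact mul_le_mul_of_nonneg_left (hY.rem s t) (abs_nonneg c)

/-- Each bound is a closed condition on finitely many values of the pair, so pointwise convergence
suffices. This drives the completeness proof. -/
lemma of_tendsto {Yn : ℕ → PathPair V X} (h : ∀ᶠ n in Filter.atTop, CtrlBound α W (Yn n) M)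
    (h1 : ∀ t, Filter.Tendsto (fun n => (Yn n).1 t) Filter.atTop (nhds (Y.1 t)))
    (h2 : ∀ t, Filter.Tendsto (fun n => (Yn n).2 t) Filter.atTop (nhds (Y.2 t))) :
    CtrlBound α W Y M where
  path t := le_of_tendsto (h1 t).norm (h.mono fun _ h => h.path t)
  deriv t := le_of_tendsto (h2 t).norm (h.mono fun _ h => h.deriv t)
  deriv_holder s t :=
    le_of_tendsto ((h2 t).sub (h2 s)).norm (h.mono fun _ h => h.deriv_holder s t)
  rem s t := by
    have : Filter.Tendsto (fun n => remainder W (Yn n) s t) Filter.atTop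
        (nhds (remainder W Y s t)) :=
      ((h1 t).sub (h1 s)).sub
        (((ContinuousLinearMap.apply ℝ X (W t - W s)).continuous.tendsto (Y.2 s)).comp (h2 s))
    exact le_of_tendsto this.norm (h.mono fun _ h => h.rem s t)

/-- The path of a controlled pair is itself Hölder. -/
lemma path_holder {w : ℝ} (hw : ∀ s t : I, ‖W t - W s‖ ≤ w * |(t : ℝ) - s| ^ (α : ℝ))
    (h : CtrlBound α W Y M) (s t : I) :
    ‖Y.1 t - Y.1 s‖ ≤ (1 + w) * M * |(t : ℝ) - s| ^ (α : ℝ) := by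
  rw [norm_sub_eq_remainder W]
  have h1 : ‖Y.2 s (W t - W s)‖ ≤ M * (w * |(t : ℝ) - s| ^ (α : ℝ)) :=
    (Y.2 s).le_of_opNorm_le_of_le (h.deriv s) (hw s t)
  have h2 : |(t : ℝ) - s| ^ (2 * (α : ℝ)) ≤ |(t : ℝ) - s| ^ (α : ℝ) :=
    Real.rpow_le_rpow_of_exponent_ge_of_imp (abs_nonneg _) (abs_sub_le_one s t)
      (by linarith [α.2]) (fun _ h => by simpa using h)
  have h3 := mul_le_mul_of_nonneg_left h2 h.nonneg
  have := norm_add_le_of_le h1 (h.rem s t)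
  nlinarith

lemma mem_controlled {w : ℝ} (hw : ∀ s t : I, ‖W t - W s‖ ≤ w * |(t : ℝ) - s| ^ (α : ℝ))
    (h : CtrlBound α W Y M) : Y ∈ controlled α W :=
  ⟨memHolder_of_bound (h.path_holder hw), memHolder_of_bound h.deriv_holder, M, h.rem⟩

end CtrlBound

/-- The properties shared by the two norms on controlled paths. -/
structure IsCtrlNorm (α : ℝ≥0) (W : I → V) (a : ℝ) (N : PathPair V X → ℝ) : Prop where
  pos : 0 < a
  bound : ∀ Y ∈ controlled α W, CtrlBound α W Y (a * N Y)
  le : ∀ Y M, CtrlBound α W Y M → N Y ≤ 4 * M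
  add_le : ∀ Y ∈ controlled α W, ∀ Z ∈ controlled α W, N (Y + Z) ≤ N Y + N Z
  smul_le : ∀ (c : ℝ), ∀ Y ∈ controlled α W, N (c • Y) ≤ |c| * N Y

/-- The space of controlled paths as a subspace. -/
def controlledSubmodule (α : ℝ≥0) (W : I → V) : Submodule ℝ (PathPair V X) where
  carrier := controlled α W
  add_mem' := by
    rintro Y Z ⟨h1, h2, C, h3⟩ ⟨k1, k2, C', k3⟩
    refine ⟨h1.add k1, h2.add k2, C + C', fun s t => ?_⟩
    rw [remainder_add, add_mul]
    exact norm_add_le_of_le (h3 s t) (k3 s t)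
  zero_mem' := ⟨memHolder_zero, memHolder_zero, 0, fun s t => by simp [remainder]⟩
  smul_mem' := by
    rintro c Y ⟨h1, h2, C, h3⟩
    refine ⟨h1.smul, h2.smul, |c| * C, fun s t => ?_⟩
    rw [remainder_smul, norm_smul, mul_assoc]
    exact mul_le_mul_of_nonneg_left (h3 s t) (abs_nonneg c)

section

variable {α : ℝ≥0} {W : I → V} {Y Z : PathPair V X}

lemma add_mem_controlled (hY : Y ∈ controlled α W) (hZ : Z ∈ controlled α W) :
    Y + Z ∈ controlled α W := by
  change Y + Z ∈ controlledSubmodule α W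
  exact Submodule.add_mem _ hY hZ

lemma sub_mem_controlled (hY : Y ∈ controlled α W) (hZ : Z ∈ controlled α W) :
    Y - Z ∈ controlled α W := by
  change Y - Z ∈ controlledSubmodule α W
  exact Submodule.sub_mem _ hY hZ

lemma neg_mem_controlled (hY : Y ∈ controlled α W) : -Y ∈ controlled α W := by
  change -Y ∈ controlledSubmodule α W
  exact Submodule.neg_mem _ hY

lemma smul_mem_controlled (c : ℝ) (hY : Y ∈ controlled α W) : c • Y ∈ controlled α W := by
  change c • Y ∈ controlledSubmodule α W
  exact Submodule.smul_mem _ c hY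

end

lemma crpSeminorm_add_le {α : ℝ≥0} (hα : 0 < α) {W : I → V} {Y Z : PathPair V X}
    (hY : Y ∈ controlled α W) (hZ : Z ∈ controlled α W) :
    crpSeminorm α W (Y + Z) ≤ crpSeminorm α W Y + crpSeminorm α W Z := by
  have hα2 : 2 * (α : ℝ) ≠ 0 := by positivity
  have h1 : (nnHolderNorm α (Y + Z).2 : ℝ) ≤ nnHolderNorm α Y.2 + nnHolderNorm α Z.2 :=
    mod_cast hY.2.1.nnHolderNorm_add_le hZ.2.1
  have h2 : holderTwo (2 * α) (remainder W (Y + Z)) ≤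
      holderTwo (2 * α) (remainder W Y) + holderTwo (2 * α) (remainder W Z) := by
    refine holderTwo_le_of_bound (add_nonneg (holderTwo_nonneg _ _) (holderTwo_nonneg _ _))
      fun s t => ?_
    rw [remainder_add, add_mul]
    exact norm_add_le_of_le (norm_le_holderTwo hα2 hY.2.2 s t) (norm_le_holderTwo hα2 hZ.2.2 s t)
  simp only [crpSeminorm]
  linarith

lemma crpSeminorm_smul_le {α : ℝ≥0} (hα : 0 < α) {W : I → V} (c : ℝ) {Y : PathPair V X}
    (hY : Y ∈ controlled α W) : crpSeminorm α W (c • Y) ≤ |c| * crpSeminorm α W Y := by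
  have hα2 : 2 * (α : ℝ) ≠ 0 := by positivity
  have h1 : (nnHolderNorm α (c • Y).2 : ℝ) ≤ |c| * nnHolderNorm α Y.2 := by
    have := hY.2.1.nnHolderNorm_smul c
    rw [show (c • Y).2 = c • Y.2 from rfl, this]
    simp
  have h2 : holderTwo (2 * α) (remainder W (c • Y)) ≤ |c| * holderTwo (2 * α) (remainder W Y) := by
    refine holderTwo_le_of_bound (mul_nonneg (abs_nonneg _) (holderTwo_nonneg _ _)) fun s t => ?_
    rw [remainder_smul, norm_smul, mul_assoc]
    exact mul_le_mul_of_nonneg_left (norm_le_holderTwo hα2 hY.2.2 s t) (abs_nonneg c)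
  simp only [crpSeminorm]
  linarith

lemma CtrlBound.crpSeminorm_le {α : ℝ≥0} {W : I → V} {Y : PathPair V X} {M : ℝ}
    (h : CtrlBound α W Y M) : crpSeminorm α W Y ≤ M + M :=
  add_le_add (nnHolderNorm_le_of_bound h.nonneg h.deriv_holder)
    (holderTwo_le_of_bound h.nonneg h.rem)

/-- The whole path is recovered from the data at time 0 and the remainder based there. The term Y'_0
W_{0,t} costs the factor w, which bounds the increments of W on [0,1]. -/
lemma isCtrlNorm_crpNorm {α : ℝ≥0} (hα : 0 < α) {W : I → V} {w : ℝ} (hw0 : 0 ≤ w)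
    (hw : ∀ s t : I, ‖W t - W s‖ ≤ w * |(t : ℝ) - s| ^ (α : ℝ)) :
    IsCtrlNorm (X := X) α W (1 + w) (crpNorm α W) where
  pos := by positivity
  bound Y hY := by
    have hα2 : 2 * (α : ℝ) ≠ 0 := by positivity
    have h1 := norm_sub_le_nnHolderNorm hY.2.1
    have h2 := norm_le_holderTwo hα2 hY.2.2
    have n1 : 0 ≤ (nnHolderNorm α Y.2 : ℝ) := NNReal.coe_nonneg _
    have n2 := holderTwo_nonneg (2 * (α : ℝ)) (remainder W Y)
    have n3 := norm_nonneg (Y.1 0)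
    have n4 := norm_nonneg (Y.2 0)
    have hN : 0 ≤ crpNorm α W Y := by simp only [crpNorm, crpSeminorm]; positivity
    have hN' : crpNorm α W Y ≤ (1 + w) * crpNorm α W Y := by nlinarith
    constructor
    · intro t
      have e : Y.1 t = Y.1 0 + (Y.2 0 (W t - W 0) + remainder W Y 0 t) := by
        simp [remainder]
      have b1 : ‖Y.2 0 (W t - W 0)‖ ≤ ‖Y.2 0‖ * w :=
        (Y.2 0).le_opNorm_of_le ((hw 0 t).trans
          (mul_le_of_le_one_right hw0 (abs_sub_rpow_le_one _ _ α.2)))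
      have b2 := (h2 0 t).trans
        (mul_le_of_le_one_right n2 (abs_sub_rpow_le_one 0 t (by positivity)))
      rw [e]
      refine (norm_add_le_of_le le_rfl (norm_add_le_of_le b1 b2)).trans ?_
      simp only [crpNorm, crpSeminorm]
      nlinarith [mul_nonneg hw0 n1, mul_nonneg hw0 n2, mul_nonneg hw0 n3]
    · intro t
      refine le_trans ?_ hN'
      have e : Y.2 t = Y.2 0 + (Y.2 t - Y.2 0) := by abel
      rw [e]
      refine (norm_add_le_of_le le_rfl ((h1 0 t).trans
        (mul_le_of_le_one_right n1 (abs_sub_rpow_le_one 0 t α.2)))).trans ?_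
      simp only [crpNorm, crpSeminorm]
      linarith
    · intro s t
      refine (h1 s t).trans ?_
      gcongr
      refine le_trans ?_ hN'
      simp only [crpNorm, crpSeminorm]
      linarith
    · intro s t
      refine (h2 s t).trans ?_
      gcongr
      refine le_trans ?_ hN'
      simp only [crpNorm, crpSeminorm]
      linarith
  -- The norm has four terms, each at most M.
  le Y M h := by
    have := h.crpSeminorm_le
    have h1 := h.path 0
    have h2 := h.deriv 0
    simp only [crpNorm]
    linarith
  add_le Y hY Z hZ := by
    have := crpSeminorm_add_le hα hY hZ
    have h1 := norm_add_le (Y.1 0) (Z.1 0)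
    have h2 := norm_add_le (Y.2 0) (Z.2 0)
    simp only [crpNorm, Prod.fst_add, Prod.snd_add, Pi.add_apply]
    linarith
  smul_le c Y hY := by
    have := crpSeminorm_smul_le hα c hY
    simp only [crpNorm, Prod.smul_fst, Prod.smul_snd, Pi.smul_apply, norm_smul, Real.norm_eq_abs]
    linarith

lemma bddAbove_norm_of_memHolder {α : ℝ≥0} {f : I → E} (hf : MemHolder α f) :
    BddAbove (Set.range fun t => ‖f t‖) := by
  refine ⟨‖f 0‖ + nnHolderNorm α f, ?_⟩
  rintro _ ⟨t, rfl⟩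
  have e : f t = f 0 + (f t - f 0) := by abel
  dsimp only
  rw [e]
  exact norm_add_le_of_le le_rfl ((norm_sub_le_nnHolderNorm hf 0 t).trans
    (mul_le_of_le_one_right (NNReal.coe_nonneg _) (abs_sub_rpow_le_one 0 t α.2)))

lemma isCtrlNorm_crpSupNorm {α : ℝ≥0} (hα : 0 < α) {W : I → V} {w : ℝ} (hw0 : 0 ≤ w) :
    IsCtrlNorm (X := X) α W (1 + w) (crpSupNorm α W) where
  pos := by positivity
  bound Y hY := by
    have hα2 : 2 * (α : ℝ) ≠ 0 := by positivity
    have n1 : 0 ≤ (nnHolderNorm α Y.2 : ℝ) := NNReal.coe_nonneg _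
    have n2 := holderTwo_nonneg (2 * (α : ℝ)) (remainder W Y)
    have n3 : 0 ≤ ⨆ t : I, ‖Y.1 t‖ := Real.iSup_nonneg fun _ => norm_nonneg _
    have n4 : 0 ≤ ⨆ t : I, ‖Y.2 t‖ := Real.iSup_nonneg fun _ => norm_nonneg _
    have hN : 0 ≤ crpSupNorm α W Y := by simp only [crpSupNorm, crpSeminorm]; positivity
    have key : CtrlBound α W Y (crpSupNorm α W Y) := by
      constructor
      · intro t
        have := le_ciSup (bddAbove_norm_of_memHolder hY.1) t
        simp only [crpSupNorm, crpSeminorm]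
        linarith
      · intro t
        have := le_ciSup (bddAbove_norm_of_memHolder hY.2.1) t
        simp only [crpSupNorm, crpSeminorm]
        linarith
      · intro s t
        refine (norm_sub_le_nnHolderNorm hY.2.1 s t).trans ?_
        gcongr
        simp only [crpSupNorm, crpSeminorm]
        linarith
      · intro s t
        refine (norm_le_holderTwo hα2 hY.2.2 s t).trans ?_
        gcongr
        simp only [crpSupNorm, crpSeminorm]
        linarith
    -- Constant 1 would do here; 1 + w lets both norms share the same constant.
    exact key.mono (by nlinarith)
  le Y M h := by
    have := h.crpSeminorm_le
    have h1 := ciSup_le h.path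
    have h2 := ciSup_le h.deriv
    simp only [crpSupNorm]
    linarith
  add_le Y hY Z hZ := by
    have := crpSeminorm_add_le hα hY hZ
    have h1 : ⨆ t, ‖(Y + Z).1 t‖ ≤ (⨆ t, ‖Y.1 t‖) + ⨆ t, ‖Z.1 t‖ := ciSup_le fun t =>
      norm_add_le_of_le (le_ciSup (bddAbove_norm_of_memHolder hY.1) t)
        (le_ciSup (bddAbove_norm_of_memHolder hZ.1) t)
    have h2 : ⨆ t, ‖(Y + Z).2 t‖ ≤ (⨆ t, ‖Y.2 t‖) + ⨆ t, ‖Z.2 t‖ := ciSup_le fun t =>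
      norm_add_le_of_le (le_ciSup (bddAbove_norm_of_memHolder hY.2.1) t)
        (le_ciSup (bddAbove_norm_of_memHolder hZ.2.1) t)
    simp only [crpSupNorm]
    linarith
  smul_le c Y hY := by
    have := crpSeminorm_smul_le hα c hY
    simp only [crpSupNorm, Prod.smul_fst, Prod.smul_snd, Pi.smul_apply, norm_smul,
      Real.norm_eq_abs, ← Real.mul_iSup_of_nonneg (abs_nonneg c)]
    linarith

end Norms

/-! ### Completeness and Banach's theorem for controlled paths. -/

section FixedPoint

open Filter Topology

/-- Banach's fixed point theorem for a complete group norm. -/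
lemma existsUnique_fixedPoint_of_addGroupNorm {E : Type*} [AddCommGroup E] (N : AddGroupNorm E)
    (hN : ∀ u : ℕ → E, (∀ ε > 0, ∃ n₀, ∀ m ≥ n₀, ∀ n ≥ n₀, N (u m - u n) < ε) →
      ∃ x, ∀ ε > 0, ∃ n₀, ∀ n ≥ n₀, N (u n - x) < ε)
    (Φ : E → E) {K : ℝ} (hK0 : 0 ≤ K) (hK1 : K < 1) (hΦ : ∀ x y, N (Φ x - Φ y) ≤ K * N (x - y)) :
    ∃! x, Φ x = x := by
  let : NormedAddCommGroup E := N.toNormedAddCommGroup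
  have hd : ∀ x y : E, dist x y = N (x - y) := fun x y => by rw [dist_eq_norm]; rfl
  have : CompleteSpace E := by
    refine Metric.complete_of_cauchySeq_tendsto fun u hu => ?_
    rw [Metric.cauchySeq_iff] at hu
    obtain ⟨x, hx⟩ := hN u (by simpa only [hd] using hu)
    exact ⟨x, Metric.tendsto_atTop.2 (by simpa only [hd] using hx)⟩
  have hc : ContractingWith ⟨K, hK0⟩ Φ :=
    ⟨by exact_mod_cast hK1, LipschitzWith.of_dist_le_mul fun x y => by
      rw [hd, hd]; exact hΦ x y⟩
  exact ⟨hc.fixedPoint, hc.fixedPoint_isFixedPt, fun y hy => hc.fixedPoint_unique hy⟩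

variable {V X : Type*}
  [NormedAddCommGroup V] [InnerProductSpace ℝ V]
  [NormedAddCommGroup X] [NormedSpace ℝ X]
  {α : ℝ≥0} {W : I → V} {a : ℝ} {N : PathPair V X → ℝ}

namespace IsCtrlNorm

lemma nonneg (h : IsCtrlNorm α W a N) {Y : PathPair V X} (hY : Y ∈ controlled α W) : 0 ≤ N Y :=
  nonneg_of_mul_nonneg_right (h.bound Y hY).nonneg h.pos

lemma map_zero (h : IsCtrlNorm α W a N) : N 0 = 0 := by
  refine le_antisymm ?_ (h.nonneg (controlledSubmodule α W).zero_mem)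
  have := h.smul_le 0 0 (controlledSubmodule α W).zero_mem
  simpa using this

lemma map_neg_le (h : IsCtrlNorm α W a N) {Y : PathPair V X} (hY : Y ∈ controlled α W) :
    N (-Y) ≤ N Y := by
  simpa using h.smul_le (-1) Y hY

/-- The restriction of the norm to the space of controlled paths. -/
def addGroupNorm (h : IsCtrlNorm α W a N) : AddGroupNorm (controlledSubmodule (X := X) α W) where
  toFun Y := N Y
  map_zero' := h.map_zero
  add_le' Y Z := h.add_le _ Y.2 _ Z.2
  neg' Y := by
    refine le_antisymm (h.map_neg_le Y.2) ?_
    simpa using h.map_neg_le (neg_mem_controlled Y.2)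
  eq_zero_of_map_eq_zero' Y hY := by
    have hb := h.bound _ Y.2
    rw [hY, mul_zero] at hb
    refine Subtype.ext (Prod.ext (funext fun t => ?_) (funext fun t => ?_))
    · exact norm_le_zero_iff.1 (hb.path t)
    · exact norm_le_zero_iff.1 (hb.deriv t)

/-- Completeness of the space of controlled paths. -/
lemma exists_limit [CompleteSpace X] (h : IsCtrlNorm α W a N) {w : ℝ}
    (hw : ∀ s t : I, ‖W t - W s‖ ≤ w * |(t : ℝ) - s| ^ (α : ℝ)) (u : ℕ → PathPair V X)
    (hu : ∀ n, u n ∈ controlled α W)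
    (hc : ∀ ε > 0, ∃ n₀, ∀ m ≥ n₀, ∀ n ≥ n₀, N (u m - u n) < ε) :
    ∃ Y ∈ controlled α W, ∀ ε > 0, ∃ n₀, ∀ n ≥ n₀, N (u n - Y) < ε := by
  have hsub : ∀ m n, u m - u n ∈ controlled α W := fun m n =>
    sub_mem_controlled (hu m) (hu n)
  have hb : ∀ ε > 0, ∃ n₀, ∀ m ≥ n₀, ∀ n ≥ n₀, CtrlBound α W (u m - u n) ε := by
    intro ε hε
    obtain ⟨n₀, h0⟩ := hc (ε / a) (div_pos hε h.pos)
    refine ⟨n₀, fun m hm n hn => (h.bound _ (hsub m n)).mono ?_⟩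
    have := h0 m hm n hn
    rw [lt_div_iff₀ h.pos] at this
    linarith
  have h1 : ∀ t, ∃ y, Tendsto (fun n => (u n).1 t) atTop (𝓝 y) := fun t => by
    refine cauchySeq_tendsto_of_complete (Metric.cauchySeq_iff.2 fun ε hε => ?_)
    obtain ⟨n₀, h0⟩ := hb (ε / 2) (half_pos hε)
    refine ⟨n₀, fun m hm n hn => ?_⟩
    rw [dist_eq_norm]
    exact ((h0 m hm n hn).path t).trans_lt (half_lt_self hε)
  have h2 : ∀ t, ∃ y, Tendsto (fun n => (u n).2 t) atTop (𝓝 y) := fun t => by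
    refine cauchySeq_tendsto_of_complete (Metric.cauchySeq_iff.2 fun ε hε => ?_)
    obtain ⟨n₀, h0⟩ := hb (ε / 2) (half_pos hε)
    refine ⟨n₀, fun m hm n hn => ?_⟩
    rw [dist_eq_norm]
    exact ((h0 m hm n hn).deriv t).trans_lt (half_lt_self hε)
  choose y1 hy1 using h1
  choose y2 hy2 using h2
  -- Let m tend to infinity in the Cauchy bounds for u n - u m, with n fixed.
  have hlim : ∀ ε > 0, ∃ n₀, ∀ n ≥ n₀, CtrlBound α W (u n - (y1, y2)) ε := by
    intro ε hε
    obtain ⟨n₀, h0⟩ := hb ε hε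
    refine ⟨n₀, fun n hn => CtrlBound.of_tendsto (Yn := fun m => u n - u m)
      (eventually_atTop.2 ⟨n₀, fun m hm => h0 n hn m hm⟩) (fun t => ?_) (fun t => ?_)⟩
    · exact tendsto_const_nhds.sub (hy1 t)
    · exact tendsto_const_nhds.sub (hy2 t)
  refine ⟨(y1, y2), ?_, fun ε hε => ?_⟩
  · obtain ⟨n₀, h0⟩ := hlim 1 one_pos
    have := sub_mem_controlled (hu n₀) ((h0 n₀ le_rfl).mem_controlled hw)
    rwa [sub_sub_cancel] at this
  -- Passing back to N costs a factor 4; the other factor 2 makes the inequality strict.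
  · obtain ⟨n₀, h0⟩ := hlim (ε / 8) (by positivity)
    exact ⟨n₀, fun n hn => (h.le _ _ (h0 n hn)).trans_lt (by linarith)⟩

/-- N is a genuine norm only on controlled paths, so Banach's theorem is applied to the restriction
of Φ to that invariant subspace. -/
lemma existsUnique_fixedPoint [CompleteSpace X] (h : IsCtrlNorm α W a N) {w : ℝ}
    (hw : ∀ s t : I, ‖W t - W s‖ ≤ w * |(t : ℝ) - s| ^ (α : ℝ)) (Φ : PathPair V X → PathPair V X)
    (hΦ : ∀ Y ∈ controlled α W, Φ Y ∈ controlled α W) {K : ℝ} (hK0 : 0 ≤ K) (hK1 : K < 1)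
    (hK : ∀ Y ∈ controlled α W, ∀ Z ∈ controlled α W, N (Φ Y - Φ Z) ≤ K * N (Y - Z)) :
    ∃! Y, Y ∈ controlled α W ∧ Φ Y = Y := by
  obtain ⟨Y, hY, hY'⟩ := existsUnique_fixedPoint_of_addGroupNorm h.addGroupNorm
    (fun u hu => by
      obtain ⟨Y, hY, hl⟩ := h.exists_limit hw (fun n => u n) (fun n => (u n).2) hu
      exact ⟨⟨Y, hY⟩, hl⟩)
    (fun Y => ⟨Φ Y, hΦ _ Y.2⟩) hK0 hK1 (fun Y Z => hK _ Y.2 _ Z.2)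
  refine ⟨Y, ⟨Y.2, congrArg Subtype.val hY⟩, fun Z hZ => ?_⟩
  exact congrArg Subtype.val (hY' ⟨Z, hZ.1⟩ (Subtype.ext hZ.2))

end IsCtrlNorm

end FixedPoint

/-! ### Lipschitz estimates for the cut-off. -/

section Cutoff

/-- On [0,∞) the function factors through x ↦ min x 1, which is 1-Lipschitz with values in the
compact interval [0,1], where C¹ implies Lipschitz. -/
lemma IsCutoff.exists_lipschitz {f : ℝ → ℝ} (hf : IsCutoff f) :
    ∃ L : ℝ, 0 ≤ L ∧ ∀ x y, 0 ≤ x → 0 ≤ y → |f x - f y| ≤ L * |x - y| := by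
  have h1 : ContDiffOn ℝ 1 f (Set.Icc 0 1) :=
    (hf.contDiffOn.of_le (by norm_num)).mono Set.Icc_subset_Ici_self
  obtain ⟨L, hL⟩ := h1.locallyLipschitzOn (convex_Icc 0 1)
    |>.exists_lipschitzOnWith_of_compact isCompact_Icc
  refine ⟨L, L.2, fun x y hx hy => ?_⟩
  have hmin : ∀ x, 0 ≤ x → f x = f (min x 1) := fun x _ => by
    rcases le_total x 1 with h | h
    · rw [min_eq_left h]
    · rw [min_eq_right h, hf.eq_zero x h, hf.eq_zero 1 le_rfl]
  rw [hmin x hx, hmin y hy]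
  have := hL.dist_le_mul (min x 1) ⟨le_min hx zero_le_one, min_le_right _ _⟩ (min y 1)
    ⟨le_min hy zero_le_one, min_le_right _ _⟩
  rw [Real.dist_eq, Real.dist_eq] at this
  refine this.trans (mul_le_mul_of_nonneg_left ?_ L.2)
  have := abs_min_sub_min_le_max x 1 y 1
  simpa using this

variable {V X : Type*}
  [NormedAddCommGroup V] [InnerProductSpace ℝ V]
  [NormedAddCommGroup X] [NormedSpace ℝ X]
  {α : ℝ≥0} {W : I → V} {a : ℝ} {N : PathPair V X → ℝ}

lemma cutoff_mem (f : ℝ → ℝ) (R : ℝ) {Y : PathPair V X} (hY : Y ∈ controlled α W) :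
    cutoff N f R Y ∈ controlled α W :=
  smul_mem_controlled _ hY

namespace IsCtrlNorm

lemma cutoff_le (h : IsCtrlNorm α W a N) {f : ℝ → ℝ} (hf : IsCutoff f) {R : ℝ} (hR : 0 < R)
    {Y : PathPair V X} (hY : Y ∈ controlled α W) : N (cutoff N f R Y) ≤ R := by
  have hN := h.nonneg hY
  have h1 := h.smul_le (f (N Y / R)) Y hY
  refine h1.trans ?_
  rcases le_total (N Y) R with hle | hle
  · obtain ⟨h0, h1⟩ := hf.mem_Icc (N Y / R) (by positivity)
    rw [abs_of_nonneg h0]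
    nlinarith
  · rw [hf.eq_zero _ ((one_le_div hR).2 hle)]
    simpa using hR.le

lemma norm_sub_comm (h : IsCtrlNorm α W a N) {Y Z : PathPair V X} (hY : Y ∈ controlled α W)
    (hZ : Z ∈ controlled α W) : N (Y - Z) = N (Z - Y) := by
  refine le_antisymm ?_ ?_
  · simpa using h.map_neg_le (sub_mem_controlled hZ hY)
  · simpa using h.map_neg_le (sub_mem_controlled hY hZ)

lemma abs_sub_le (h : IsCtrlNorm α W a N) {Y Z : PathPair V X} (hY : Y ∈ controlled α W)
    (hZ : Z ∈ controlled α W) : |N Y - N Z| ≤ N (Y - Z) := by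
  have h1 := h.add_le _ (sub_mem_controlled hY hZ) _ hZ
  have h2 := h.add_le _ (sub_mem_controlled hZ hY) _ hY
  rw [sub_add_cancel] at h1 h2
  rw [h.norm_sub_comm hZ hY] at h2
  rw [abs_le]
  constructor <;> linarith

/-- The cut-off is Lipschitz with a constant that does not depend on the radius. -/
lemma cutoff_sub_le (h : IsCtrlNorm α W a N) {f : ℝ → ℝ} (hf : IsCutoff f) {L : ℝ} (hL0 : 0 ≤ L)
    (hL : ∀ x y, 0 ≤ x → 0 ≤ y → |f x - f y| ≤ L * |x - y|) {R : ℝ} (hR : 0 < R)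
    {Y Z : PathPair V X} (hY : Y ∈ controlled α W) (hZ : Z ∈ controlled α W) :
    N (cutoff N f R Y - cutoff N f R Z) ≤ (L + 1) * N (Y - Z) := by
  -- The difference of the two factors will multiply the smaller path Z. Either N Z ≤ R, which
  -- absorbs the 1/R from f(·/R), or both norms are at least R and both factors vanish.
  wlog hle : N Z ≤ N Y generalizing Y Z
  · rw [h.norm_sub_comm hY hZ, h.norm_sub_comm (cutoff_mem f R hY) (cutoff_mem f R hZ)]
    exact this hZ hY (le_of_not_ge hle)
  have hNY := h.nonneg hY
  have hNZ := h.nonneg hZ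
  have hd := h.nonneg (sub_mem_controlled hY hZ)
  have e : cutoff N f R Y - cutoff N f R Z =
      f (N Y / R) • (Y - Z) + (f (N Y / R) - f (N Z / R)) • Z := by
    simp only [cutoff, smul_sub, sub_smul]; abel
  have hfY := hf.mem_Icc (N Y / R) (by positivity)
  have h1 : N (f (N Y / R) • (Y - Z)) ≤ N (Y - Z) := by
    refine (h.smul_le _ _ (sub_mem_controlled hY hZ)).trans ?_
    rw [abs_of_nonneg hfY.1]
    exact mul_le_of_le_one_left hd hfY.2
  have h2 : N ((f (N Y / R) - f (N Z / R)) • Z) ≤ L * N (Y - Z) := by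
    refine (h.smul_le _ _ hZ).trans ?_
    rcases le_total (N Z) R with hZR | hZR
    · have h3 := hL (N Y / R) (N Z / R) (by positivity) (by positivity)
      rw [← sub_div, abs_div, abs_of_pos hR] at h3
      have h4 := h.abs_sub_le hY hZ
      calc |f (N Y / R) - f (N Z / R)| * N Z ≤ (L * (N (Y - Z) / R)) * R := by
            gcongr; exact h3.trans (by gcongr)
        _ = L * N (Y - Z) := by field_simp
    · rw [hf.eq_zero _ ((one_le_div hR).2 hZR), hf.eq_zero _ ((one_le_div hR).2 (hZR.trans hle))]
      simpa using mul_nonneg hL0 hd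
  rw [e]
  have := h.add_le _ (smul_mem_controlled (f (N Y / R)) (sub_mem_controlled hY hZ)) _
    (smul_mem_controlled (f (N Y / R) - f (N Z / R)) hZ)
  linarith

end IsCtrlNorm

end Cutoff

/-! ### The sewing lemma and Riemann sums. -/

section Sewing

open Filter Topology Finset

/-- The constant in the sewing lemma of order `θ`. -/
def sewConst (θ : ℝ) : ℝ := 2 / (1 - 2 / 2 ^ θ)

lemma one_sub_two_div_rpow_pos {θ : ℝ} (hθ : 1 < θ) : 0 < 1 - 2 / (2 : ℝ) ^ θ := by
  have : (2 : ℝ) < 2 ^ θ := by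
    simpa using Real.rpow_lt_rpow_of_exponent_lt (by norm_num : (1 : ℝ) < 2) hθ
  rw [sub_pos, div_lt_one (by positivity)]
  exact this

lemma sewConst_pos {θ : ℝ} (hθ : 1 < θ) : 0 < sewConst θ :=
  div_pos two_pos (one_sub_two_div_rpow_pos hθ)

/-- This balance closes the bisection induction: two blocks of at most half the length contribute
C/2^θ each, and two additivity defects contribute 1 each. -/
lemma sewConst_eq {θ : ℝ} (hθ : 1 < θ) : 2 * (sewConst θ / 2 ^ θ) + 2 = sewConst θ := by
  have h := one_sub_two_div_rpow_pos hθ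
  have h' : sewConst θ * (1 - 2 / 2 ^ θ) = 2 := div_mul_cancel₀ _ h.ne'
  have : (0 : ℝ) < 2 ^ θ := by positivity
  linear_combination -h'

lemma exists_le_le_succ {p : ℕ → I} {m : ℝ} {a b : ℕ} (hab : a < b) (ha : (p a : ℝ) ≤ m)
    (hb : m ≤ p b) : ∃ j, a ≤ j ∧ j < b ∧ (p j : ℝ) ≤ m ∧ m ≤ p (j + 1) := by
  induction b, hab using Nat.le_induction with
  | base => exact ⟨a, le_rfl, Nat.lt_succ_self a, ha, hb⟩
  | succ b hab ih =>
    rcases le_total m (p b) with h | h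
    · obtain ⟨j, h1, h2, h3⟩ := ih h
      exact ⟨j, h1, h2.trans (Nat.lt_succ_self b), h3⟩
    · exact ⟨b, (Nat.le_of_succ_le hab), Nat.lt_succ_self b, h, hb⟩

variable {E : Type*} [NormedAddCommGroup E]

/-- `Ξ` is additive up to an error of order `θ`. -/
def AlmostAdditive (K θ : ℝ) (Ξ : I → I → E) : Prop :=
  ∀ s u t : I, s ≤ u → u ≤ t → ‖Ξ s t - Ξ s u - Ξ u t‖ ≤ K * ((t : ℝ) - s) ^ θ

variable {K θ : ℝ} {Ξ : I → I → E}

lemma AlmostAdditive.self (h : AlmostAdditive K θ Ξ) (hθ : 1 < θ) (x : I) : Ξ x x = 0 := by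
  have := h x x x le_rfl le_rfl
  rw [sub_self, sub_self, Real.zero_rpow (by linarith), mul_zero, zero_sub, norm_neg] at this
  exact norm_le_zero_iff.1 this

/-- Riemann sums along a monotone sequence stay close to the two-parameter function. -/
lemma AlmostAdditive.norm_sum_sub_le (h : AlmostAdditive K θ Ξ) (hK : 0 ≤ K) (hθ : 1 < θ)
    {p : ℕ → I} (hp : Monotone p) {a b : ℕ} (hab : a ≤ b) :
    ‖∑ k ∈ Ico a b, Ξ (p k) (p (k + 1)) - Ξ (p a) (p b)‖ ≤
      sewConst θ * K * ((p b : ℝ) - p a) ^ θ := by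
  induction hn : b - a using Nat.strong_induction_on generalizing a b with
  | _ n ih =>
  have hC := sewConst_pos hθ
  rcases hab.eq_or_lt with rfl | hlt
  · simp [h.self hθ, Real.zero_rpow (by linarith : θ ≠ 0)]
  have hpab : (p a : ℝ) ≤ p b := hp hab
  -- The cell containing the midpoint is split off, so that each of the two remaining blocks has at
  -- most half the length. Halving lengths makes the constant independent of the number of points.
  obtain ⟨j, haj, hjb, hj1, hj2⟩ := exists_le_le_succ (p := p) (m := ((p a : ℝ) + p b) / 2) hlt
    (by linarith) (by linarith)
  have hpaj : (p a : ℝ) ≤ p j := hp haj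
  have hpjb : (p (j + 1) : ℝ) ≤ p b := hp hjb
  have i1 := ih (j - a) (by omega) haj rfl
  have i2 := ih (b - (j + 1)) (by omega) (Nat.succ_le_of_lt hjb) rfl
  have d1 := h (p a) (p j) (p b) (hp haj) (hp hjb.le)
  have d2 := h (p j) (p (j + 1)) (p b) (hp j.le_succ) (hp hjb)
  set H : ℝ := (p b : ℝ) - p a with hH
  have hH0 : 0 ≤ H := sub_nonneg.2 hpab
  have e : (H / 2) ^ θ = H ^ θ / 2 ^ θ := Real.div_rpow hH0 (by norm_num) θ
  have b1 : ((p j : ℝ) - p a) ^ θ ≤ H ^ θ / 2 ^ θ := by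
    rw [← e]; exact Real.rpow_le_rpow (by linarith) (by linarith) (by linarith)
  have b2 : ((p b : ℝ) - p (j + 1)) ^ θ ≤ H ^ θ / 2 ^ θ := by
    rw [← e]; exact Real.rpow_le_rpow (by linarith) (by linarith) (by linarith)
  have b3 : ((p b : ℝ) - p j) ^ θ ≤ H ^ θ :=
    Real.rpow_le_rpow (by have : (p j : ℝ) ≤ p b := hp hjb.le
                          linarith) (by linarith) (by linarith)
  have i1' := i1.trans (mul_le_mul_of_nonneg_left b1 (by positivity))
  have i2' := i2.trans (mul_le_mul_of_nonneg_left b2 (by positivity))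
  have d2' := d2.trans (mul_le_mul_of_nonneg_left b3 hK)
  have hsum : ∑ k ∈ Ico a b, Ξ (p k) (p (k + 1)) =
      ∑ k ∈ Ico a j, Ξ (p k) (p (k + 1)) +
        (Ξ (p j) (p (j + 1)) + ∑ k ∈ Ico (j + 1) b, Ξ (p k) (p (k + 1))) := by
    rw [← sum_Ico_consecutive _ haj hjb.le, sum_eq_sum_Ico_succ_bot hjb]
  have hdec : ∑ k ∈ Ico a b, Ξ (p k) (p (k + 1)) - Ξ (p a) (p b) =
      (∑ k ∈ Ico a j, Ξ (p k) (p (k + 1)) - Ξ (p a) (p j)) +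
      (∑ k ∈ Ico (j + 1) b, Ξ (p k) (p (k + 1)) - Ξ (p (j + 1)) (p b)) -
      (Ξ (p a) (p b) - Ξ (p a) (p j) - Ξ (p j) (p b)) -
      (Ξ (p j) (p b) - Ξ (p j) (p (j + 1)) - Ξ (p (j + 1)) (p b)) := by
    rw [hsum]; abel
  rw [hdec]
  refine (norm_sub_le_of_le (norm_sub_le_of_le (norm_add_le_of_le i1' i2') d1) d2').trans
    (le_of_eq ?_)
  have := sewConst_eq hθ
  linear_combination (K * H ^ θ) * this

/-- Sums of powers of the increments of a monotone sequence. -/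
lemma sum_rpow_le {p : ℕ → I} (hp : Monotone p) {m : ℕ} {η : ℝ} (hθ : 1 < θ)
    (hη : ∀ k < m, (p (k + 1) : ℝ) - p k ≤ η) :
    ∑ k ∈ range m, ((p (k + 1) : ℝ) - p k) ^ θ ≤ η ^ (θ - 1) * ((p m : ℝ) - p 0) := by
  rw [← sum_range_sub (fun k => (p k : ℝ)) m, mul_sum]
  refine sum_le_sum fun k hk => ?_
  have h0 : 0 ≤ (p (k + 1) : ℝ) - p k := sub_nonneg.2 (hp k.le_succ)
  have e : ((p (k + 1) : ℝ) - p k) ^ θ = ((p (k + 1) : ℝ) - p k) ^ (θ - 1) *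
      ((p (k + 1) : ℝ) - p k) := by
    conv_lhs => rw [show θ = θ - 1 + 1 by ring]
    rw [Real.rpow_add_one' h0 (by linarith)]
  rw [e]
  exact mul_le_mul_of_nonneg_right
    (Real.rpow_le_rpow h0 (hη k (mem_range.1 hk)) (by linarith)) h0

/-- The dyadic points of the unit interval. -/
def dyadic (n k : ℕ) : I := Set.projIcc 0 1 zero_le_one ((k : ℝ) / 2 ^ n)

lemma dyadic_mono (n : ℕ) : Monotone (dyadic n) := fun k l h =>
  Set.monotone_projIcc _ (by gcongr)

lemma dyadic_zero (n : ℕ) : dyadic n 0 = 0 := by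
  simp [dyadic]

lemma dyadic_last (n : ℕ) : dyadic n (2 ^ n) = 1 := by
  simp [dyadic]

lemma dyadic_succ_two_mul (n k : ℕ) : dyadic (n + 1) (2 * k) = dyadic n k := by
  simp only [dyadic]
  congr 1
  push_cast
  field_simp
  ring

lemma dyadic_sub_le (n k : ℕ) : (dyadic n (k + 1) : ℝ) - dyadic n k ≤ 1 / 2 ^ n := by
  refine (le_abs_self _).trans ((Set.abs_projIcc_sub_projIcc zero_le_one).trans (le_of_eq ?_))
  rw [← sub_div, Nat.cast_add_one, add_sub_cancel_left, abs_of_nonneg (by positivity)]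

/-- Truncation to the interval `[s, t]`. -/
def clamp (s t x : I) : I := max s (min x t)

lemma clamp_mono (s t : I) : Monotone (clamp s t) := fun _ _ h =>
  max_le_max le_rfl (min_le_min h le_rfl)

lemma clamp_sub_le (s t : I) {x y : I} (hxy : x ≤ y) :
    (clamp s t y : ℝ) - clamp s t x ≤ (y : ℝ) - x := by
  have h : (x : ℝ) ≤ y := hxy
  have hc : Monotone ((↑) : I → ℝ) := Subtype.mono_coe _
  rw [clamp, clamp, hc.map_max, hc.map_min, hc.map_max, hc.map_min]
  have h1 := abs_max_sub_max_le_max (s : ℝ) (min y t) s (min x t)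
  have h2 := abs_min_sub_min_le_max (y : ℝ) t x t
  rw [sub_self, abs_zero] at h1 h2
  have h3 := h2.trans_eq (max_eq_left (abs_nonneg _))
  rw [abs_of_nonneg (sub_nonneg.2 h)] at h3
  exact (le_abs_self _).trans (h1.trans (max_le (sub_nonneg.2 h) h3))

/-- The dyadic Riemann sum over `[s, t]`. -/
def dyadicSum (Ξ : I → I → E) (n : ℕ) (s t : I) : E :=
  ∑ k ∈ range (2 ^ n), Ξ (clamp s t (dyadic n k)) (clamp s t (dyadic n (k + 1)))

lemma AlmostAdditive.norm_dyadicSum_sub_le (h : AlmostAdditive K θ Ξ) (hK : 0 ≤ K) (hθ : 1 < θ)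
    (n : ℕ) {s t : I} (hst : s ≤ t) :
    ‖dyadicSum Ξ n s t - Ξ s t‖ ≤ sewConst θ * K * ((t : ℝ) - s) ^ θ := by
  have := h.norm_sum_sub_le hK hθ (p := fun k => clamp s t (dyadic n k))
    ((clamp_mono s t).comp (dyadic_mono n)) (Nat.zero_le (2 ^ n))
  have e0 : clamp s t 0 = s := by
    rw [clamp, min_eq_left unitInterval.nonneg', max_eq_left unitInterval.nonneg']
  have e1 : clamp s t 1 = t := by
    rw [clamp, min_eq_right unitInterval.le_one', max_eq_right hst]
  simpa [dyadic_zero, dyadic_last, e0, e1, dyadicSum] using this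

/-- Cells have length at most 2^{-n} and total length at most 1, so the excess exponent θ - 1 > 0
yields geometric decay. Both the Cauchy property and the additivity of the limit rest on this. -/
lemma sum_clamp_dyadic_rpow_le (hθ : 1 < θ) (n : ℕ) (s t : I) :
    ∑ k ∈ range (2 ^ n), ((clamp s t (dyadic n (k + 1)) : ℝ) - clamp s t (dyadic n k)) ^ θ ≤
      ((1 / 2) ^ (θ - 1)) ^ n := by
  have := sum_rpow_le (p := fun k => clamp s t (dyadic n k))
    ((clamp_mono s t).comp (dyadic_mono n)) (m := 2 ^ n) (η := 1 / 2 ^ n) hθ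
    fun k _ => (clamp_sub_le s t (dyadic_mono n k.le_succ)).trans (dyadic_sub_le n k)
  refine this.trans ?_
  have e : ((1 / 2 : ℝ) ^ (θ - 1)) ^ n = (1 / 2 ^ n) ^ (θ - 1) := by
    rw [← Real.rpow_natCast, ← Real.rpow_mul (by norm_num), mul_comm, Real.rpow_mul (by norm_num),
      Real.rpow_natCast, one_div_pow]
  rw [e]
  refine mul_le_of_le_one_right (by positivity) ?_
  exact (le_abs_self _).trans (abs_sub_le_one _ _)

lemma sum_range_two_mul (g : ℕ → E) (m : ℕ) :
    ∑ k ∈ range (2 * m), g k = ∑ k ∈ range m, (g (2 * k) + g (2 * k + 1)) := by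
  induction m with
  | zero => simp
  | succ m ih => rw [mul_add, mul_one, sum_range_succ, sum_range_succ, ih, sum_range_succ, add_assoc]

/-- Refining the grid splits every cell once, at the cost of one additivity defect per cell. -/
lemma AlmostAdditive.dist_dyadicSum_le (h : AlmostAdditive K θ Ξ) (hK : 0 ≤ K) (hθ : 1 < θ)
    (n : ℕ) (s t : I) :
    dist (dyadicSum Ξ n s t) (dyadicSum Ξ (n + 1) s t) ≤ K * ((1 / 2) ^ (θ - 1)) ^ n := by
  rw [dist_eq_norm, dyadicSum, dyadicSum, pow_succ', sum_range_two_mul, ← sum_sub_distrib]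
  refine (norm_sum_le _ _).trans (le_trans ?_ (mul_le_mul_of_nonneg_left
    (sum_clamp_dyadic_rpow_le hθ n s t) hK))
  rw [mul_sum]
  refine sum_le_sum fun k _ => ?_
  have := h (clamp s t (dyadic (n + 1) (2 * k))) (clamp s t (dyadic (n + 1) (2 * k + 1)))
    (clamp s t (dyadic (n + 1) (2 * (k + 1))))
    (clamp_mono s t (dyadic_mono _ (by omega))) (clamp_mono s t (dyadic_mono _ (by omega)))
  rw [dyadic_succ_two_mul, dyadic_succ_two_mul, sub_sub] at this
  rw [dyadic_succ_two_mul, show 2 * k + 1 + 1 = 2 * (k + 1) by ring, dyadic_succ_two_mul]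
  exact this

/-- Only a cell with u in its interior creates a defect. For a cell on one side of u, one truncation
collapses to the point u, where Ξ vanishes, and the other two coincide. -/
lemma AlmostAdditive.norm_clamp_le (h : AlmostAdditive K θ Ξ) (hK : 0 ≤ K) (hθ : 1 < θ)
    {s u t a b : I} (hsu : s ≤ u) (hut : u ≤ t) (hab : a ≤ b) :
    ‖Ξ (clamp s t a) (clamp s t b) - Ξ (clamp s u a) (clamp s u b) -
      Ξ (clamp u t a) (clamp u t b)‖ ≤ K * ((clamp s t b : ℝ) - clamp s t a) ^ θ := by
  have hst := hsu.trans hut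
  have hnn : 0 ≤ K * ((clamp s t b : ℝ) - clamp s t a) ^ θ :=
    mul_nonneg hK (Real.rpow_nonneg (sub_nonneg.2 (clamp_mono s t hab)) _)
  rcases le_total u a with hua | hua
  · have hub := hua.trans hab
    have e1 : clamp s u a = u := by simp [clamp, hua, hsu]
    have e2 : clamp s u b = u := by simp [clamp, hub, hsu]
    have e3 : ∀ x, u ≤ x → clamp u t x = clamp s t x := fun x hx => by
      rw [clamp, clamp, max_eq_right (le_min hx hut), max_eq_right (le_min (hsu.trans hx) hst)]
    rw [e1, e2, e3 a hua, e3 b hub, h.self hθ]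
    simpa using hnn
  rcases le_total b u with hbu | hbu
  · have e1 : clamp u t a = u := by
      rw [clamp, max_eq_left ((min_le_left _ _).trans hua)]
    have e2 : clamp u t b = u := by
      rw [clamp, max_eq_left ((min_le_left _ _).trans hbu)]
    have e3 : ∀ x, x ≤ u → clamp s u x = clamp s t x := fun x hx => by
      rw [clamp, clamp, min_eq_left hx, min_eq_left (hx.trans hut)]
    rw [e1, e2, e3 a hua, e3 b hbu, h.self hθ]
    simpa using hnn
  · have e1 : clamp s u b = u := by simp [clamp, hbu, hsu]
    have e2 : clamp u t a = u := by
      rw [clamp, max_eq_left ((min_le_left _ _).trans hua)]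
    have e3 : clamp s u a = clamp s t a := by
      rw [clamp, clamp, min_eq_left hua, min_eq_left (hua.trans hut)]
    have e4 : clamp u t b = clamp s t b := by
      rw [clamp, clamp, max_eq_right (le_min hbu hut), max_eq_right (le_min (hsu.trans hbu) hst)]
    rw [e1, e2, e3, e4]
    refine h _ _ _ ?_ ?_
    · rw [clamp, min_eq_left (hua.trans hut)]; exact max_le hsu hua
    · rw [← e4]; exact le_max_left _ _

/-- A single grid truncated to all three intervals, instead of a grid rescaled to each, makes the
sums comparable cell by cell; the limit is therefore additive. -/
lemma AlmostAdditive.norm_dyadicSum_add_le (h : AlmostAdditive K θ Ξ) (hK : 0 ≤ K) (hθ : 1 < θ)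
    (n : ℕ) {s u t : I} (hsu : s ≤ u) (hut : u ≤ t) :
    ‖dyadicSum Ξ n s t - dyadicSum Ξ n s u - dyadicSum Ξ n u t‖ ≤
      K * ((1 / 2) ^ (θ - 1)) ^ n := by
  rw [dyadicSum, dyadicSum, dyadicSum, ← sum_sub_distrib, ← sum_sub_distrib]
  refine (norm_sum_le _ _).trans (le_trans ?_ (mul_le_mul_of_nonneg_left
    (sum_clamp_dyadic_rpow_le hθ n s t) hK))
  rw [mul_sum]
  exact sum_le_sum fun k _ => h.norm_clamp_le hK hθ hsu hut (dyadic_mono n k.le_succ)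

/-- The sewing lemma. -/
theorem AlmostAdditive.exists_path [CompleteSpace E] (h : AlmostAdditive K θ Ξ) (hK : 0 ≤ K)
    (hθ : 1 < θ) : ∃ J : I → E, J 0 = 0 ∧
      ∀ s t : I, s ≤ t → ‖J t - J s - Ξ s t‖ ≤ sewConst θ * K * ((t : ℝ) - s) ^ θ := by
  have hr : (1 / 2 : ℝ) ^ (θ - 1) < 1 :=
    Real.rpow_lt_one (by norm_num) (by norm_num) (by linarith)
  have hr0 : (0 : ℝ) ≤ (1 / 2 : ℝ) ^ (θ - 1) := by positivity
  have hlim : ∀ t : I, ∃ y, Tendsto (fun n => dyadicSum Ξ n 0 t) atTop (𝓝 y) := fun t =>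
    cauchySeq_tendsto_of_complete
      (cauchySeq_of_le_geometric _ _ hr fun n => h.dist_dyadicSum_le hK hθ n 0 t)
  choose J hJ using hlim
  refine ⟨J, ?_, fun s t hst => ?_⟩
  · refine tendsto_nhds_unique (hJ 0) (tendsto_const_nhds.congr fun n => ?_)
    have : ∀ x : I, clamp 0 0 x = 0 := fun x => by
      simp [clamp]
    simp [dyadicSum, this, h.self hθ]
  · have h1 : Tendsto (fun n => ‖dyadicSum Ξ n 0 t - dyadicSum Ξ n 0 s - Ξ s t‖) atTop
        (𝓝 ‖J t - J s - Ξ s t‖) := (((hJ t).sub (hJ s)).sub_const _).norm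
    have h2 : Tendsto (fun n : ℕ => K * ((1 / 2 : ℝ) ^ (θ - 1)) ^ n +
        sewConst θ * K * ((t : ℝ) - s) ^ θ) atTop (𝓝 (K * 0 + sewConst θ * K * ((t : ℝ) - s) ^ θ)) :=
      ((tendsto_pow_atTop_nhds_zero_of_lt_one hr0 hr).const_mul K).add_const _
    rw [mul_zero, zero_add] at h2
    refine le_of_tendsto_of_tendsto' h1 h2 fun n => ?_
    have e : dyadicSum Ξ n 0 t - dyadicSum Ξ n 0 s - Ξ s t =
        (dyadicSum Ξ n 0 t - dyadicSum Ξ n 0 s - dyadicSum Ξ n s t) +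
        (dyadicSum Ξ n s t - Ξ s t) := by abel
    rw [e]
    exact norm_add_le_of_le (h.norm_dyadicSum_add_le hK hθ n unitInterval.nonneg' hst)
      (h.norm_dyadicSum_sub_le hK hθ n hst)

/-- The points of a partition as a monotone sequence. -/
def Partition.seq {s t : I} (P : Partition s t) (k : ℕ) : I :=
  P.pt ⟨min k P.n, by omega⟩

lemma Partition.seq_mono {s t : I} (P : Partition s t) : Monotone P.seq := fun k l h =>
  P.strictMono.monotone (by simp only [Fin.mk_le_mk]; omega)

lemma Partition.seq_zero {s t : I} (P : Partition s t) : P.seq 0 = s := by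
  refine Eq.trans ?_ P.pt_zero
  simp [seq]

lemma Partition.seq_last {s t : I} (P : Partition s t) : P.seq P.n = t := by
  refine Eq.trans ?_ P.pt_last
  simp [seq, Fin.last]

lemma Partition.seq_castSucc {s t : I} (P : Partition s t) (i : Fin P.n) :
    P.pt i.castSucc = P.seq i := by
  rw [seq]; congr 1; ext; simp [i.2.le]

lemma Partition.seq_succ {s t : I} (P : Partition s t) (i : Fin P.n) :
    P.pt i.succ = P.seq (i + 1) := by
  rw [seq]; congr 1; ext; simp [Nat.succ_le_of_lt i.2]

lemma Partition.sum_eq {s t : I} (P : Partition s t) (g : I → I → E) :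
    ∑ i : Fin P.n, g (P.pt i.castSucc) (P.pt i.succ) =
      ∑ k ∈ range P.n, g (P.seq k) (P.seq (k + 1)) := by
  rw [← Fin.sum_univ_eq_sum_range (fun k => g (P.seq k) (P.seq (k + 1)))]
  simp only [P.seq_castSucc, P.seq_succ]

/-- Riemann sums over fine partitions are close to the sewn path. -/
lemma Partition.norm_sum_sub_le {s t : I} (P : Partition s t) {J : I → E} {c η : ℝ} (hc : 0 ≤ c)
    (hθ : 1 < θ) (hJ : ∀ s t : I, s ≤ t → ‖J t - J s - Ξ s t‖ ≤ c * ((t : ℝ) - s) ^ θ)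
    (hη0 : 0 ≤ η) (hη : ∀ i : Fin P.n, (P.pt i.succ : ℝ) - P.pt i.castSucc ≤ η) :
    ‖∑ i : Fin P.n, Ξ (P.pt i.castSucc) (P.pt i.succ) - (J t - J s)‖ ≤ c * η ^ (θ - 1) := by
  rw [P.sum_eq Ξ]
  have e : J t - J s = ∑ k ∈ range P.n, (J (P.seq (k + 1)) - J (P.seq k)) := by
    rw [sum_range_sub (fun k => J (P.seq k)), P.seq_zero, P.seq_last]
  rw [e, ← sum_sub_distrib]
  have h1 : ∀ k ∈ range P.n, ‖Ξ (P.seq k) (P.seq (k + 1)) - (J (P.seq (k + 1)) - J (P.seq k))‖ ≤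
      c * ((P.seq (k + 1) : ℝ) - P.seq k) ^ θ := fun k _ => by
    rw [norm_sub_rev]
    exact hJ _ _ (P.seq_mono k.le_succ)
  refine (norm_sum_le_of_le _ h1).trans ?_
  rw [← mul_sum]
  refine mul_le_mul_of_nonneg_left ?_ hc
  have h2 := sum_rpow_le P.seq_mono (m := P.n) (η := η) hθ fun k hk => by
    have := hη ⟨k, hk⟩
    rwa [P.seq_castSucc, P.seq_succ] at this
  refine h2.trans (mul_le_of_le_one_right (by positivity) ?_)
  exact (le_abs_self _).trans (abs_sub_le_one _ _)

/-- There are partitions with arbitrarily small mesh. -/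
lemma exists_partition {s t : I} (hst : s ≤ t) {δ : ℝ} (hδ : 0 < δ) :
    ∃ P : Partition s t, ∀ i : Fin P.n, (P.pt i.succ : ℝ) - P.pt i.castSucc < δ := by
  rcases hst.eq_or_lt with rfl | hlt
  -- For s = t strict monotonicity allows only the one-point partition.
  · exact ⟨⟨0, fun _ => s, fun i j h => by omega, rfl, rfl⟩, fun i => i.elim0⟩
  have hlt' : (0 : ℝ) < (t : ℝ) - s := sub_pos.2 hlt
  obtain ⟨m, hm⟩ := exists_nat_one_div_lt hδ
  have hx : ∀ x : ℝ, 0 ≤ x → x ≤ 1 → (s : ℝ) + x * (t - s) ∈ I := fun x h0 h1 =>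
    ⟨by nlinarith [s.2.1], by nlinarith [t.2.2]⟩
  refine ⟨⟨m + 1, fun i => ⟨s + (i : ℕ) / ((m : ℝ) + 1) * (t - s), hx _ (by positivity) ?_⟩,
    fun i j h => ?_, ?_, ?_⟩, fun i => ?_⟩
  · rw [div_le_one (by positivity)]
    exact_mod_cast Nat.lt_succ_iff.1 i.2
  · have : (i : ℕ) < j := h
    simp only [Subtype.mk_lt_mk]
    gcongr
  · ext; simp
  · ext
    simp only [Fin.val_last]
    push_cast
    field_simp
    ring
  · simp only [Fin.val_succ, Fin.val_castSucc]
    push_cast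
    have : (t : ℝ) - s ≤ 1 := (le_abs_self _).trans (abs_sub_le_one _ _)
    calc (s : ℝ) + ((i : ℕ) + 1) / ((m : ℝ) + 1) * (t - s) - (s + (i : ℕ) / ((m : ℝ) + 1) * (t - s))
        = 1 / ((m : ℝ) + 1) * (t - s) := by ring
      _ ≤ 1 / ((m : ℝ) + 1) := mul_le_of_le_one_right (by positivity) this
      _ < δ := hm

end Sewing

/-! ### The rough integral of a controlled path. -/

section RoughIntegral

variable {V X X' : Type*}
  [NormedAddCommGroup V] [InnerProductSpace ℝ V]
  [NormedAddCommGroup X] [NormedSpace ℝ X] [NormedAddCommGroup X'] [NormedSpace ℝ X']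

@[simp]
lemma applyTensor_tmul (B : V →L[ℝ] V →L[ℝ] X) (v w : V) : applyTensor B (v ⊗ₜ[ℝ] w) = B v w := by
  simp [applyTensor]

lemma applyTensor_add (B C : V →L[ℝ] V →L[ℝ] X) :
    applyTensor (B + C) = applyTensor B + applyTensor C :=
  TensorProduct.ext' fun v w => by simp

lemma applyTensor_smul (c : ℝ) (B : V →L[ℝ] V →L[ℝ] X) :
    applyTensor (c • B) = c • applyTensor B :=
  TensorProduct.ext' fun v w => by simp

lemma applyTensor_sub (B C : V →L[ℝ] V →L[ℝ] X) :
    applyTensor (B - C) = applyTensor B - applyTensor C :=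
  TensorProduct.ext' fun v w => by simp

lemma applyTensor_compL (T : X →L[ℝ] X') (B : V →L[ℝ] V →L[ℝ] X) (τ : V ⊗[ℝ] V) :
    applyTensor ((ContinuousLinearMap.compL ℝ V X X' T).comp B) τ = T (applyTensor B τ) := by
  have : applyTensor ((ContinuousLinearMap.compL ℝ V X X' T).comp B) =
      (T : X →ₗ[ℝ] X').comp (applyTensor B) :=
    TensorProduct.ext' fun v w => by simp
  rw [this]; rfl

/-- Finite dimension makes bilinear maps continuous, so the particular norm on V ⊗ V plays no role.
-/
lemma exists_bilinear_bound {E F G : Type*} [NormedAddCommGroup E] [NormedSpace ℝ E]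
    [FiniteDimensional ℝ E] [NormedAddCommGroup F] [NormedSpace ℝ F] [FiniteDimensional ℝ F]
    [NormedAddCommGroup G] [NormedSpace ℝ G] {f : E → F → G} (hf : IsBilinearMap ℝ f) :
    ∃ κ : ℝ, 0 ≤ κ ∧ ∀ x y, ‖f x y‖ ≤ κ * ‖x‖ * ‖y‖ := by
  let Λ : E →L[ℝ] F →L[ℝ] G := hf.toContinuousBilinearMap
  exact ⟨‖Λ‖, norm_nonneg Λ, fun x y => Λ.le_opNorm₂ x y⟩

lemma exists_applyTensor_bound [FiniteDimensional ℝ V] [FiniteDimensional ℝ X] :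
    ∃ κ : ℝ, 0 ≤ κ ∧ ∀ (B : V →L[ℝ] V →L[ℝ] X) (τ : V ⊗[ℝ] V),
      ‖applyTensor B τ‖ ≤ κ * ‖B‖ * ‖τ‖ :=
  exists_bilinear_bound (F := V ⊗[ℝ] V) (f := fun (B : V →L[ℝ] V →L[ℝ] X) τ => applyTensor B τ)
    { add_left := fun B C τ => by simp [applyTensor_add]
      smul_left := fun c B τ => by simp [applyTensor_smul]
      add_right := fun B τ ρ => map_add (applyTensor B) τ ρ
      smul_right := fun c B τ => map_smul (applyTensor B) c τ }

variable {α : ℝ≥0}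

lemma RoughPath.exists_bounds (W : RoughPath α V) : ∃ w c : ℝ, 0 ≤ w ∧ 0 ≤ c ∧
    (∀ s t : I, ‖W.path t - W.path s‖ ≤ w * |(t : ℝ) - s| ^ (α : ℝ)) ∧
    ∀ s t : I, ‖W.area s t‖ ≤ c * |(t : ℝ) - s| ^ (2 * (α : ℝ)) := by
  obtain ⟨w, hw⟩ := W.path_holder
  obtain ⟨c, hc⟩ := W.area_holder
  refine ⟨w, max c 0, w.2, le_max_right _ _, holderWith_iff.1 hw, fun s t => (hc s t).trans ?_⟩
  gcongr
  exact le_max_left _ _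

/-- The summand `Z_s W_{s,t} + Z'_s 𝕎_{s,t}` of the compensated Riemann sums. -/
def germ (W : RoughPath α V) (Z : PathPair V (V →L[ℝ] X)) (s t : I) : X :=
  Z.1 s (W.path t - W.path s) + applyTensor (Z.2 s) (W.area s t)

lemma compensatedSum_eq (W : RoughPath α V) (Z : PathPair V (V →L[ℝ] X)) {s t : I}
    (P : Partition s t) :
    compensatedSum W Z P = ∑ i : Fin P.n, germ W Z (P.pt i.castSucc) (P.pt i.succ) := rfl

/-- By Chen's relation the second-order term contributes Z'_s W_{s,u} applied to W_{u,t}, exactly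
what completes Z_s - Z_u to minus the remainder. -/
lemma germ_sub_sub (W : RoughPath α V) (Z : PathPair V (V →L[ℝ] X)) (s u t : I) :
    germ W Z s t - germ W Z s u - germ W Z u t =
      -(remainder W.path Z s u (W.path t - W.path u)) -
        applyTensor (Z.2 u - Z.2 s) (W.area u t) := by
  have h : W.area s t = W.area s u + W.area u t +
      (W.path u - W.path s) ⊗ₜ[ℝ] (W.path t - W.path u) := by
    rw [← W.chen s u t]; abel
  simp only [germ, h, remainder, map_add, applyTensor_tmul, applyTensor_sub, map_sub,
    sub_apply, LinearMap.sub_apply]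
  abel

/-- Each defect term pairs an order 2α with an order α: the remainder with W, and the area with the
increment of Z'. -/
lemma almostAdditive_germ {W : RoughPath α V} {w c κ M : ℝ} (hw0 : 0 ≤ w) (hc0 : 0 ≤ c)
    (hκ0 : 0 ≤ κ)
    (hw : ∀ s t : I, ‖W.path t - W.path s‖ ≤ w * |(t : ℝ) - s| ^ (α : ℝ))
    (hc : ∀ s t : I, ‖W.area s t‖ ≤ c * |(t : ℝ) - s| ^ (2 * (α : ℝ)))
    (hκ : ∀ (B : V →L[ℝ] V →L[ℝ] X) (τ : V ⊗[ℝ] V), ‖applyTensor B τ‖ ≤ κ * ‖B‖ * ‖τ‖)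
    {Z : PathPair V (V →L[ℝ] X)} (hZ : CtrlBound α W.path Z M) :
    AlmostAdditive ((w + κ * c) * M) (3 * α) (germ W Z) := by
  intro s u t hsu hut
  have hM := hZ.nonneg
  have hsu' : (s : ℝ) ≤ u := hsu
  have hut' : (u : ℝ) ≤ t := hut
  have h0 : 0 ≤ (t : ℝ) - s := by linarith
  have r1 : |(u : ℝ) - s| ^ (α : ℝ) ≤ ((t : ℝ) - s) ^ (α : ℝ) := by
    rw [abs_of_nonneg (by linarith)]; gcongr
  have r2 : |(t : ℝ) - u| ^ (α : ℝ) ≤ ((t : ℝ) - s) ^ (α : ℝ) := by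
    rw [abs_of_nonneg (by linarith)]; gcongr
  have r3 : |(u : ℝ) - s| ^ (2 * (α : ℝ)) ≤ ((t : ℝ) - s) ^ (2 * (α : ℝ)) := by
    rw [abs_of_nonneg (by linarith)]; gcongr
  have r4 : |(t : ℝ) - u| ^ (2 * (α : ℝ)) ≤ ((t : ℝ) - s) ^ (2 * (α : ℝ)) := by
    rw [abs_of_nonneg (by linarith)]; gcongr
  have e : ((t : ℝ) - s) ^ (3 * (α : ℝ)) =
      ((t : ℝ) - s) ^ (2 * (α : ℝ)) * ((t : ℝ) - s) ^ (α : ℝ) := by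
    rw [← Real.rpow_add_of_nonneg h0 (by positivity) α.coe_nonneg]; congr 1; ring
  set x := ((t : ℝ) - s) ^ (2 * (α : ℝ))
  set y := ((t : ℝ) - s) ^ (α : ℝ)
  have hx : 0 ≤ x := Real.rpow_nonneg h0 _
  have hy : 0 ≤ y := Real.rpow_nonneg h0 _
  rw [germ_sub_sub]
  have b1 : ‖remainder W.path Z s u (W.path t - W.path u)‖ ≤ (M * x) * (w * y) :=
    ContinuousLinearMap.le_of_opNorm_le_of_le _ ((hZ.rem s u).trans (by gcongr))
      ((hw u t).trans (by gcongr))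
  have b2 : ‖applyTensor (Z.2 u - Z.2 s) (W.area u t)‖ ≤ κ * (M * y) * (c * x) := by
    refine (hκ _ _).trans ?_
    gcongr
    · exact (hZ.deriv_holder s u).trans (by gcongr)
    · exact (hc u t).trans (by gcongr)
  refine (norm_sub_le_of_le ((norm_neg _).trans_le b1) b2).trans (le_of_eq ?_)
  rw [e]
  ring

lemma IsRoughIntegral.unique {W : RoughPath α V} {Z : PathPair V (V →L[ℝ] X)} {s t : I}
    (hst : s ≤ t) {J J' : X} (h : IsRoughIntegral W Z s t J) (h' : IsRoughIntegral W Z s t J') :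
    J = J' := by
  refine eq_of_forall_dist_le fun ε hε => ?_
  obtain ⟨δ, hδ, H⟩ := h (ε / 2) (half_pos hε)
  obtain ⟨δ', hδ', H'⟩ := h' (ε / 2) (half_pos hε)
  obtain ⟨P, hP⟩ := exists_partition hst (lt_min hδ hδ')
  have h1 := H P fun i => (hP i).trans_le (min_le_left _ _)
  have h2 := H' P fun i => (hP i).trans_le (min_le_right _ _)
  rw [← dist_eq_norm] at h1 h2
  have := dist_triangle_left J J' (compensatedSum W Z P)
  linarith

lemma IsRoughIntegral.roughIntegral_eq {W : RoughPath α V} {Z : PathPair V (V →L[ℝ] X)} {s t : I}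
    (hst : s ≤ t) {J : X} (h : IsRoughIntegral W Z s t J) : roughIntegral W Z s t = J := by
  have hex : ∃ J, IsRoughIntegral W Z s t J := ⟨J, h⟩
  rw [roughIntegral, dif_pos hex]
  exact hex.choose_spec.unique hst h

lemma IsRoughIntegral.sub {W : RoughPath α V} {Y Z : PathPair V (V →L[ℝ] X)} {s t : I} {J J' : X}
    (h : IsRoughIntegral W Y s t J) (h' : IsRoughIntegral W Z s t J') :
    IsRoughIntegral W (Y - Z) s t (J - J') := by
  intro ε hε
  obtain ⟨δ, hδ, H⟩ := h (ε / 2) (half_pos hε)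
  obtain ⟨δ', hδ', H'⟩ := h' (ε / 2) (half_pos hε)
  refine ⟨min δ δ', lt_min hδ hδ', fun P hP => ?_⟩
  have h1 := H P fun i => (hP i).trans_le (min_le_left _ _)
  have h2 := H' P fun i => (hP i).trans_le (min_le_right _ _)
  have e : compensatedSum W (Y - Z) P - (J - J') =
      (compensatedSum W Y P - J) - (compensatedSum W Z P - J') := by
    have : compensatedSum W (Y - Z) P = compensatedSum W Y P - compensatedSum W Z P := by
      simp only [compensatedSum, ← Finset.sum_sub_distrib]
      refine Finset.sum_congr rfl fun i _ => ?_
      simp only [Prod.fst_sub, Prod.snd_sub, Pi.sub_apply, applyTensor_sub,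
        sub_apply, LinearMap.sub_apply]
      abel
    rw [this]; abel
  rw [e]
  exact (norm_sub_le _ _).trans_lt (by linarith)

/-- Rough integration commutes with a bounded operator. -/
lemma IsRoughIntegral.map {W : RoughPath α V} {Z : PathPair V (V →L[ℝ] X)} {s t : I} {J : X}
    (h : IsRoughIntegral W Z s t J) (T : X →L[ℝ] X') :
    IsRoughIntegral W (X := X') (fun r => T.comp (Z.1 r),
      fun r => (ContinuousLinearMap.compL ℝ V X X' T).comp (Z.2 r)) s t (T J) := by
  intro ε hε
  obtain ⟨δ, hδ, H⟩ := h (ε / (‖T‖ + 1)) (by positivity)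
  refine ⟨δ, hδ, fun P hP => ?_⟩
  have e : compensatedSum W (X := X') (fun r => T.comp (Z.1 r),
      fun r => (ContinuousLinearMap.compL ℝ V X X' T).comp (Z.2 r)) P =
      T (compensatedSum W Z P) := by
    simp only [compensatedSum, map_sum, map_add, applyTensor_compL,
      ContinuousLinearMap.comp_apply]
  rw [e, ← map_sub]
  have h1 := H P hP
  rw [lt_div_iff₀ (by positivity)] at h1
  refine (T.le_opNorm _).trans_lt ?_
  nlinarith [norm_nonneg (compensatedSum W Z P - J)]

/-- Existence of the rough integral, as a controlled path. -/
theorem exists_roughIntegral_path [FiniteDimensional ℝ V] [FiniteDimensional ℝ X]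
    (hα : (1 / 3 : ℝ) < α) (W : RoughPath α V) :
    ∃ C : ℝ, 0 ≤ C ∧ ∀ (Z : PathPair V (V →L[ℝ] X)) (M : ℝ), CtrlBound α W.path Z M →
      ∃ J : I → X, (∀ s t : I, s ≤ t → IsRoughIntegral W Z s t (J t - J s)) ∧ J 0 = 0 ∧
        CtrlBound α W.path (J, Z.1) (C * M) := by
  obtain ⟨w, c, hw0, hc0, hw, hc⟩ := W.exists_bounds
  obtain ⟨κ, hκ0, hκ⟩ := exists_applyTensor_bound (V := V) (X := X)
  have hθ : (1 : ℝ) < 3 * α := by linarith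
  have hS := sewConst_pos hθ
  set S := sewConst (3 * (α : ℝ))
  set b := S * (w + κ * c) + κ * c + (1 + w) * w with hb
  have hb0 : 0 ≤ b := by positivity
  -- This dominates b + w, 1, 1 + w and b, the constants required by the four bounds.
  refine ⟨1 + (b + 2 * w), by positivity, fun Z M hZ => ?_⟩
  have hM := hZ.nonneg
  obtain ⟨J, hJ0, hJ⟩ := (almostAdditive_germ hw0 hc0 hκ0 hw hc hκ hZ).exists_path
    (by positivity) hθ
  have rem_le : ∀ s t : I, s ≤ t → ‖J t - J s - Z.1 s (W.path t - W.path s)‖ ≤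
      (S * (w + κ * c) + κ * c) * M * |(t : ℝ) - s| ^ (2 * (α : ℝ)) := by
    intro s t hst
    have e : J t - J s - Z.1 s (W.path t - W.path s) =
        (J t - J s - germ W Z s t) + applyTensor (Z.2 s) (W.area s t) := by
      rw [germ]; abel
    have h1 : ((t : ℝ) - s) ^ (3 * (α : ℝ)) ≤ |(t : ℝ) - s| ^ (2 * (α : ℝ)) := by
      have h0 : 0 ≤ (t : ℝ) - s := sub_nonneg.2 hst
      rw [abs_of_nonneg h0]
      exact Real.rpow_le_rpow_of_exponent_ge_of_imp h0
        ((le_abs_self _).trans (abs_sub_le_one s t)) (by linarith) (fun _ h => by linarith)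
    have h2 : ‖applyTensor (Z.2 s) (W.area s t)‖ ≤
        κ * M * (c * |(t : ℝ) - s| ^ (2 * (α : ℝ))) := by
      refine (hκ _ _).trans ?_
      gcongr
      · exact hZ.deriv s
      · exact hc s t
    rw [e]
    refine (norm_add_le_of_le ((hJ s t hst).trans
      (mul_le_mul_of_nonneg_left h1 (by positivity))) h2).trans (le_of_eq ?_)
    ring
  have rem_le' : ∀ s t : I, ‖J t - J s - Z.1 s (W.path t - W.path s)‖ ≤
      b * M * |(t : ℝ) - s| ^ (2 * (α : ℝ)) := by
    intro s t
    have hh : 0 ≤ |(t : ℝ) - s| ^ (2 * (α : ℝ)) := by positivity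
    rcases le_total s t with hst | hts
    · refine (rem_le s t hst).trans ?_
      gcongr
      rw [hb]
      nlinarith
    -- Sewing controls ordered pairs only. Exchanging the endpoints costs the increment of Z applied
    -- to that of W, which has order α + α.
    · have e : J t - J s - Z.1 s (W.path t - W.path s) =
          (Z.1 t - Z.1 s) (W.path t - W.path s) -
            (J s - J t - Z.1 t (W.path s - W.path t)) := by
        simp only [sub_apply, map_sub]; abel
      have h1 := rem_le t s hts
      rw [abs_sub_comm] at h1
      have h2 : ‖(Z.1 t - Z.1 s) (W.path t - W.path s)‖ ≤
          ((1 + w) * M * |(t : ℝ) - s| ^ (α : ℝ)) * (w * |(t : ℝ) - s| ^ (α : ℝ)) :=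
        ContinuousLinearMap.le_of_opNorm_le_of_le _ (hZ.path_holder hw s t) (hw s t)
      have h3 : |(t : ℝ) - s| ^ (2 * (α : ℝ)) =
          |(t : ℝ) - s| ^ (α : ℝ) * |(t : ℝ) - s| ^ (α : ℝ) := by
        rw [← Real.rpow_add_of_nonneg (abs_nonneg _) α.coe_nonneg α.coe_nonneg, two_mul]
      rw [e]
      refine (norm_sub_le_of_le h2 h1).trans (le_of_eq ?_)
      rw [hb, h3]
      ring
  refine ⟨J, fun s t _ => ?_, hJ0, ?_⟩
  · intro ε hε
    set d := S * ((w + κ * c) * M)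
    have hd : 0 ≤ d := by positivity
    have hpos : 0 < ε / (d + 1) := by positivity
    -- With this mesh the error d δ^{3α-1} becomes d ε/(d + 1) < ε.
    refine ⟨(ε / (d + 1)) ^ (3 * (α : ℝ) - 1)⁻¹, by positivity, fun P hP => ?_⟩
    have := P.norm_sum_sub_le hd hθ hJ (by positivity) (fun i => (hP i).le)
    rw [compensatedSum_eq]
    refine this.trans_lt ?_
    rw [Real.rpow_inv_rpow hpos.le (by linarith), mul_div_assoc', div_lt_iff₀ (by positivity)]
    nlinarith
  · constructor
    · intro t
      have e : J t = (J t - J 0 - Z.1 0 (W.path t - W.path 0)) + Z.1 0 (W.path t - W.path 0) := by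
        rw [hJ0]; abel
      have h1 := (rem_le' 0 t).trans (mul_le_of_le_one_right (by positivity)
        (abs_sub_rpow_le_one 0 t (by positivity)))
      have h2 : ‖Z.1 0 (W.path t - W.path 0)‖ ≤ M * w :=
        ContinuousLinearMap.le_of_opNorm_le_of_le _ (hZ.path 0) ((hw 0 t).trans
          (mul_le_of_le_one_right hw0 (abs_sub_rpow_le_one 0 t α.2)))
      change ‖J t‖ ≤ _
      rw [e]
      refine (norm_add_le_of_le h1 h2).trans ?_
      nlinarith [mul_nonneg hw0 hM]
    · intro t
      refine (hZ.path t).trans ?_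
      nlinarith [mul_nonneg hw0 hM, mul_nonneg hb0 hM]
    · intro s t
      refine (hZ.path_holder hw s t).trans ?_
      gcongr
      linarith
    · intro s t
      refine (rem_le' s t).trans ?_
      gcongr
      linarith

end RoughIntegral

/-! ### Convolution with the group, as a controlled path. -/

section Convolution

variable {V X X' : Type*}
  [NormedAddCommGroup V] [InnerProductSpace ℝ V]
  [NormedAddCommGroup X] [NormedSpace ℝ X] [NormedAddCommGroup X'] [NormedSpace ℝ X']
  {α : ℝ≥0}

/-- Here α ≤ 1/2 enters: whatever is Lipschitz in time counts as a remainder of order 2α. -/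
lemma abs_sub_le_rpow (hα' : (α : ℝ) ≤ 1 / 2) (s t : I) :
    |(t : ℝ) - s| ≤ |(t : ℝ) - s| ^ (2 * (α : ℝ)) := by
  rcases (abs_nonneg ((t : ℝ) - s)).eq_or_lt with h | h
  · rw [← h]; positivity
  · simpa using Real.rpow_le_rpow_of_exponent_ge h (abs_sub_le_one s t)
      (by linarith : 2 * (α : ℝ) ≤ 1)

lemma rpow_two_mul_le (s t : I) :
    |(t : ℝ) - s| ^ (2 * (α : ℝ)) ≤ |(t : ℝ) - s| ^ (α : ℝ) :=
  Real.rpow_le_rpow_of_exponent_ge_of_imp (abs_nonneg _) (abs_sub_le_one s t)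
    (by linarith [α.coe_nonneg]) (fun _ h => by simpa using h)

/-- The product of a controlled path with a path of operators. -/
def mulPair (Φ : I → X →L[ℝ] X') (Y : PathPair V X) : PathPair V X' :=
  (fun t => Φ t (Y.1 t), fun t => (Φ t).comp (Y.2 t))

/-- Increments of Φ are of order 2α, so they enter the remainder only, and the Gubinelli derivative
of ΦY is simply ΦY'. -/
lemma CtrlBound.mulPair {W : I → V} {Y : PathPair V X} {M S : ℝ} (hY : CtrlBound α W Y M)
    (hα' : (α : ℝ) ≤ 1 / 2) {Φ : I → X →L[ℝ] X'} (h1 : ∀ t, ‖Φ t‖ ≤ S)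
    (h2 : ∀ s t : I, ‖Φ t - Φ s‖ ≤ S * |(t : ℝ) - s|) :
    CtrlBound α W (mulPair Φ Y) (2 * S * M) := by
  have hM := hY.nonneg
  have hS : 0 ≤ S := (norm_nonneg _).trans (h1 0)
  have h3 : ∀ s t : I, ‖Φ t - Φ s‖ ≤ S * |(t : ℝ) - s| ^ (2 * (α : ℝ)) := fun s t =>
    (h2 s t).trans (mul_le_mul_of_nonneg_left (abs_sub_le_rpow hα' s t) hS)
  have h4 : ∀ s t : I, ‖Φ t - Φ s‖ ≤ S * |(t : ℝ) - s| ^ (α : ℝ) := fun s t =>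
    (h3 s t).trans (mul_le_mul_of_nonneg_left (rpow_two_mul_le s t) hS)
  have hSM := mul_nonneg hS hM
  constructor
  · intro t
    refine ((Φ t).le_of_opNorm_le_of_le (h1 t) (hY.path t)).trans ?_
    linarith
  · intro t
    refine ((Φ t).opNorm_comp_le (Y.2 t)).trans
      ((mul_le_mul (h1 t) (hY.deriv t) (norm_nonneg _) hS).trans ?_)
    linarith
  · intro s t
    have e : (RoughCutoff.mulPair Φ Y).2 t - (RoughCutoff.mulPair Φ Y).2 s =
        (Φ t - Φ s).comp (Y.2 t) + (Φ s).comp (Y.2 t - Y.2 s) := by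
      simp [RoughCutoff.mulPair]
    rw [e]
    refine (norm_add_le_of_le
      ((ContinuousLinearMap.opNorm_comp_le _ _).trans
        (mul_le_mul (h4 s t) (hY.deriv t) (norm_nonneg _) (by positivity)))
      ((ContinuousLinearMap.opNorm_comp_le _ _).trans
        (mul_le_mul (h1 s) (hY.deriv_holder s t) (norm_nonneg _) hS))).trans (le_of_eq ?_)
    ring
  · intro s t
    have e : remainder W (RoughCutoff.mulPair Φ Y) s t =
        (Φ t - Φ s) (Y.1 t) + Φ s (remainder W Y s t) := by
      simp [RoughCutoff.mulPair, remainder]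
      abel
    rw [e]
    refine (norm_add_le_of_le
      (ContinuousLinearMap.le_of_opNorm_le_of_le _ (h3 s t) (hY.path t))
      (ContinuousLinearMap.le_of_opNorm_le_of_le _ (h1 s) (hY.rem s t))).trans (le_of_eq ?_)
    ring

lemma sg_zero (A : X →L[ℝ] X) : sg A 0 = ContinuousLinearMap.id ℝ X := by
  rw [sg, zero_smul, NormedSpace.exp_zero]; rfl

lemma shifted_eq_mulPair (A : X →L[ℝ] X) (t : I) (Z : PathPair V (V →L[ℝ] X)) :
    shifted A t Z =
      mulPair (fun r => ContinuousLinearMap.compL ℝ V X X (sg A ((t : ℝ) - r))) Z := rfl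

/-- The controlled path `(∫_0^· S(·-r) φ_r dr + ∫_0^· S(·-r) Z_r d𝐖_r, Z)`. -/
def convPair (W : RoughPath α V) (A : X →L[ℝ] X) (φ : I → X) (Z : PathPair V (V →L[ℝ] X)) :
    PathPair V X :=
  (fun t => driftConv A id φ t + roughConv W A Z t, Z.1)

/-- With `F` and `G` absorbed into the data, the convolution is linear and differences can be
estimated through it. -/
lemma mildMap_eq_convPair (W : RoughPath α V) (A : X →L[ℝ] X) (F : X → X) (G : X → V →L[ℝ] X)
    (N : PathPair V X → ℝ) (f : ℝ → ℝ) (R : ℝ) (Y : PathPair V X) :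
    mildMap W A F G N f R Y =
      convPair W A (fun t => F ((cutoff N f R Y).1 t)) (compose G (cutoff N f R Y)) := rfl

variable [CompleteSpace X]

lemma sg_add (A : X →L[ℝ] X) (s t : ℝ) : sg A (s + t) = (sg A s).comp (sg A t) := by
  let : NormedAlgebra ℚ (X →L[ℝ] X) := NormedAlgebra.restrictScalars ℚ ℝ (X →L[ℝ] X)
  rw [sg, add_smul, NormedSpace.exp_add_of_commute (((Commute.refl A).smul_left s).smul_right t)]
  rfl

lemma hasDerivAt_sg (A : X →L[ℝ] X) (t : ℝ) : HasDerivAt (sg A) (sg A t * A) t :=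
  hasDerivAt_exp_smul_const A t

lemma continuous_sg (A : X →L[ℝ] X) : Continuous (sg A) :=
  continuous_iff_continuousAt.2 fun t => (hasDerivAt_sg A t).continuousAt

/-- The interval [-1,1] contains all differences t - r, including the negative ones met when the
shifted integrand is considered on all of [0,1]. -/
lemma exists_sg_bound (A : X →L[ℝ] X) : ∃ S : ℝ, 0 ≤ S ∧
    (∀ x ∈ Set.Icc (-1 : ℝ) 1, ‖sg A x‖ ≤ S) ∧
    ∀ x ∈ Set.Icc (-1 : ℝ) 1, ∀ y ∈ Set.Icc (-1 : ℝ) 1, ‖sg A y - sg A x‖ ≤ S * |y - x| := by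
  obtain ⟨S, hS⟩ := (isCompact_Icc (a := (-1 : ℝ)) (b := 1)).exists_bound_of_continuousOn
    (continuous_sg A).continuousOn
  have hS0 : 0 ≤ S := (norm_nonneg _).trans (hS 0 (by norm_num))
  refine ⟨S * (1 + ‖A‖), by positivity, fun x hx => (hS x hx).trans ?_, fun x hx y hy => ?_⟩
  · nlinarith [mul_nonneg hS0 (norm_nonneg A)]
  · have := (convex_Icc (-1 : ℝ) 1).norm_image_sub_le_of_norm_hasDerivWithin_le
      (fun z _ => (hasDerivAt_sg A z).hasDerivWithinAt)
      (fun z hz => (norm_mul_le _ _).trans (mul_le_mul_of_nonneg_right (hS z hz) (norm_nonneg A)))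
      hx hy
    refine this.trans ?_
    rw [Real.norm_eq_abs]
    gcongr
    linarith

lemma exists_shifted_bound (hα' : (α : ℝ) ≤ 1 / 2) (A : X →L[ℝ] X) :
    ∃ C : ℝ, 0 ≤ C ∧ ∀ (W : I → V) (Z : PathPair V (V →L[ℝ] X)) (M : ℝ) (t : I),
      CtrlBound α W Z M → CtrlBound α W (shifted A t Z) (C * M) := by
  obtain ⟨S, hS0, hS1, hS2⟩ := exists_sg_bound A
  refine ⟨2 * S, by positivity, fun W Z M t hZ => ?_⟩
  have hmem : ∀ r : I, (t : ℝ) - r ∈ Set.Icc (-1 : ℝ) 1 := fun r =>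
    ⟨by linarith [t.2.1, r.2.2], by linarith [t.2.2, r.2.1]⟩
  have hc : ∀ T : X →L[ℝ] X, ‖ContinuousLinearMap.compL ℝ V X X T‖ ≤ ‖T‖ := fun T =>
    ContinuousLinearMap.opNorm_le_bound _ (norm_nonneg T) fun f => T.opNorm_comp_le f
  rw [shifted_eq_mulPair]
  refine hZ.mulPair hα' (fun r => (hc _).trans (hS1 _ (hmem r))) fun r s => ?_
  rw [← map_sub]
  refine (hc _).trans ((hS2 _ (hmem r) _ (hmem s)).trans (le_of_eq ?_))
  rw [abs_sub_comm]
  ring_nf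

/-- The rough convolution as a controlled path. -/
theorem exists_roughConv_bound [FiniteDimensional ℝ V] [FiniteDimensional ℝ X]
    (hα : (1 / 3 : ℝ) < α) (hα' : (α : ℝ) ≤ 1 / 2) (W : RoughPath α V) (A : X →L[ℝ] X) :
    ∃ C : ℝ, 0 ≤ C ∧ ∀ (Z : PathPair V (V →L[ℝ] X)) (M : ℝ), CtrlBound α W.path Z M →
      (∀ t, IsRoughIntegral W (shifted A t Z) 0 t (roughConv W A Z t)) ∧
        CtrlBound α W.path (roughConv W A Z, Z.1) (C * M) := by
  obtain ⟨S, hS0, hS1, hS2⟩ := exists_sg_bound A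
  obtain ⟨C₁, hC₁, h1⟩ := exists_shifted_bound (V := V) hα' A
  obtain ⟨C₂, hC₂, h2⟩ := exists_roughIntegral_path (X := X) hα W
  refine ⟨2 * S * (C₂ * C₁), by positivity, fun Z M hZ => ?_⟩
  -- J integrates S(-r)Z_r once for all t; the convolution is then S(t)J_t by the group law.
  obtain ⟨J, hJ, hJ0, hJb⟩ := h2 _ _ (h1 W.path Z M 0 hZ)
  have hsg : ∀ t r : ℝ, (sg A t).comp (sg A ((0 : I) - r)) = sg A (t - r) := fun t r => by
    rw [← sg_add]; congr 1; simp [sub_eq_add_neg]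
  have hint : ∀ t, IsRoughIntegral W (shifted A t Z) 0 t (sg A t (J t)) := fun t => by
    have := (hJ 0 t unitInterval.nonneg').map (sg A t)
    rw [hJ0, sub_zero] at this
    convert this using 1
    refine Prod.ext (funext fun r => ?_) (funext fun r => ?_)
    · change (sg A ((t : ℝ) - r)).comp (Z.1 r) =
        (sg A t).comp ((sg A (((0 : I) : ℝ) - r)).comp (Z.1 r))
      rw [← ContinuousLinearMap.comp_assoc, hsg]
    · refine ContinuousLinearMap.ext fun v => ?_
      change (sg A ((t : ℝ) - r)).comp (Z.2 r v) =
        (sg A t).comp ((sg A (((0 : I) : ℝ) - r)).comp (Z.2 r v))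
      rw [← ContinuousLinearMap.comp_assoc, hsg]
  have hconv : ∀ t, roughConv W A Z t = sg A t (J t) := fun t =>
    (hint t).roughIntegral_eq unitInterval.nonneg'
  refine ⟨fun t => by rw [hconv]; exact hint t, ?_⟩
  have hmem : ∀ r : I, (r : ℝ) ∈ Set.Icc (-1 : ℝ) 1 := fun r =>
    ⟨by linarith [r.2.1], r.2.2⟩
  have hm := hJb.mulPair hα' (Φ := fun t : I => sg A t) (fun t => hS1 _ (hmem t))
    (fun s t => hS2 _ (hmem s) _ (hmem t))
  -- The Gubinelli derivative is S(t)S(-t)Z_t = Z_t.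
  have e : mulPair (fun t : I => sg A t) (J, (shifted A 0 Z).1) = (roughConv W A Z, Z.1) := by
    refine Prod.ext (funext fun t => (hconv t).symm) (funext fun t => ?_)
    change (sg A t).comp ((sg A (((0 : I) : ℝ) - t)).comp (Z.1 t)) = Z.1 t
    rw [← ContinuousLinearMap.comp_assoc, hsg, sub_self, sg_zero, ContinuousLinearMap.id_comp]
  rw [e] at hm
  exact hm.mono (le_of_eq (by ring))

lemma continuous_driftIntegrand (A : X →L[ℝ] X) {φ : I → X} (hφ : Continuous φ) (t : I) :
    Continuous (driftIntegrand A id φ t) :=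
  ((continuous_sg A).comp (continuous_const.sub continuous_id)).clm_apply
    (hφ.comp continuous_projIcc)

lemma driftConv_sub (A : X →L[ℝ] X) {φ ψ : I → X} (hφ : Continuous φ) (hψ : Continuous ψ) (t : I) :
    driftConv A id (φ - ψ) t = driftConv A id φ t - driftConv A id ψ t := by
  rw [driftConv, driftConv, driftConv, ← intervalIntegral.integral_sub
    ((continuous_driftIntegrand A hφ t).intervalIntegrable _ _)
    ((continuous_driftIntegrand A hψ t).intervalIntegrable _ _)]
  simp [driftIntegrand]

/-- The drift convolution as a controlled path with vanishing derivative. -/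
theorem exists_driftConv_bound (hα' : (α : ℝ) ≤ 1 / 2) (A : X →L[ℝ] X) :
    ∃ C : ℝ, 0 ≤ C ∧ ∀ (W : I → V) (φ : I → X) (m : ℝ), Continuous φ → (∀ t, ‖φ t‖ ≤ m) →
      CtrlBound α W (driftConv A id φ, 0) (C * m) := by
  obtain ⟨S, hS0, hS1, hS2⟩ := exists_sg_bound A
  refine ⟨2 * S * S, by positivity, fun W φ m hφ hm => ?_⟩
  have hm0 : 0 ≤ m := (norm_nonneg _).trans (hm 0)
  have hcont := continuous_driftIntegrand A hφ 0
  have hbound : ∀ s t : I, ∀ r ∈ Set.uIoc (s : ℝ) t, ‖driftIntegrand A id φ 0 r‖ ≤ S * m := by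
    intro s t r hr
    have hr' : r ∈ Set.Icc (0 : ℝ) 1 := by
      have := Set.uIoc_subset_uIcc hr
      rw [Set.mem_uIcc] at this
      rcases this with h | h
      · exact ⟨s.2.1.trans h.1, h.2.trans t.2.2⟩
      · exact ⟨t.2.1.trans h.1, h.2.trans s.2.2⟩
    refine ContinuousLinearMap.le_of_opNorm_le_of_le _ (hS1 _ ?_) (hm _)
    rw [Set.Icc.coe_zero, zero_sub]
    exact ⟨by linarith [hr'.2], by linarith [hr'.1]⟩
  -- The same factorisation for the drift: h is Lipschitz in time and the convolution is S(t)h(t).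
  set h : I → X := fun t => ∫ r in (0 : ℝ)..t, driftIntegrand A id φ 0 r with hh
  have hLip : ∀ s t : I, ‖h t - h s‖ ≤ S * m * |(t : ℝ) - s| := fun s t => by
    rw [hh]
    simp only
    rw [intervalIntegral.integral_interval_sub_left (hcont.intervalIntegrable _ _)
      (hcont.intervalIntegrable _ _)]
    exact intervalIntegral.norm_integral_le_of_norm_le_const (hbound s t)
  have hpair : CtrlBound α W ((h, 0) : PathPair V X) (S * m) := by
    constructor
    · intro t
      have := hLip 0 t
      have h0 : h 0 = 0 := by simp [hh]
      rw [h0, sub_zero] at this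
      exact this.trans (mul_le_of_le_one_right (by positivity) (abs_sub_le_one _ _))
    · intro t
      simpa using mul_nonneg hS0 hm0
    · intro s t
      simp only [Pi.zero_apply, sub_zero, norm_zero]
      positivity
    · intro s t
      simp only [remainder, Pi.zero_apply, zero_apply, sub_zero]
      refine (hLip s t).trans ?_
      gcongr
      exact abs_sub_le_rpow hα' s t
  have hmem : ∀ r : I, (r : ℝ) ∈ Set.Icc (-1 : ℝ) 1 := fun r =>
    ⟨by linarith [r.2.1], r.2.2⟩
  have hmul := hpair.mulPair hα' (Φ := fun t : I => sg A t) (fun t => hS1 _ (hmem t))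
    (fun s t => hS2 _ (hmem s) _ (hmem t))
  have e : mulPair (fun t : I => sg A t) ((h, 0) : PathPair V X) = (driftConv A id φ, 0) := by
    refine Prod.ext (funext fun t => ?_) (funext fun t => ?_)
    · change sg A t (h t) = driftConv A id φ t
      rw [hh, driftConv]
      simp only
      rw [← ContinuousLinearMap.intervalIntegral_comp_comm _ (hcont.intervalIntegrable _ _)]
      refine intervalIntegral.integral_congr fun r _ => ?_
      simp only [driftIntegrand]
      rw [← ContinuousLinearMap.comp_apply, ← sg_add]
      simp [sub_eq_add_neg]
    · change (sg A t).comp (0 : V →L[ℝ] X) = 0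
      exact ContinuousLinearMap.comp_zero _
  rw [e] at hmul
  exact hmul.mono (le_of_eq (by ring))

/-- The difference estimate is the growth estimate applied to differences. The bounds M₁ and M₂ do
not enter the constant: they ensure that both rough integrals exist, so that `roughIntegral` is
additive rather than a default value. -/
theorem exists_convPair_bound [FiniteDimensional ℝ V] [FiniteDimensional ℝ X]
    (hα : (1 / 3 : ℝ) < α) (hα' : (α : ℝ) ≤ 1 / 2) (W : RoughPath α V) (A : X →L[ℝ] X) :
    ∃ C : ℝ, 0 ≤ C ∧
      (∀ (φ : I → X) (Z : PathPair V (V →L[ℝ] X)) (m M : ℝ), Continuous φ → (∀ t, ‖φ t‖ ≤ m) →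
        CtrlBound α W.path Z M → CtrlBound α W.path (convPair W A φ Z) (C * (m + M))) ∧
      ∀ (φ ψ : I → X) (Y Z : PathPair V (V →L[ℝ] X)) (m M M₁ M₂ : ℝ), Continuous φ →
        Continuous ψ → (∀ t, ‖φ t - ψ t‖ ≤ m) → CtrlBound α W.path Y M₁ →
        CtrlBound α W.path Z M₂ → CtrlBound α W.path (Y - Z) M →
        CtrlBound α W.path (convPair W A φ Y - convPair W A ψ Z) (C * (m + M)) := by
  obtain ⟨C₁, hC₁, h1⟩ := exists_driftConv_bound (V := V) hα' A
  obtain ⟨C₂, hC₂, h2⟩ := exists_roughConv_bound hα hα' W A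
  have key : ∀ (φ : I → X) (Z : PathPair V (V →L[ℝ] X)) (m M : ℝ), Continuous φ →
      (∀ t, ‖φ t‖ ≤ m) → CtrlBound α W.path Z M →
      CtrlBound α W.path (convPair W A φ Z) ((C₁ + C₂) * (m + M)) := by
    intro φ Z m M hφ hm hZ
    have hm0 : 0 ≤ m := (norm_nonneg _).trans (hm 0)
    have hM := hZ.nonneg
    have := (h1 W.path φ m hφ hm).add (h2 Z M hZ).2
    have e : ((driftConv A id φ, 0) : PathPair V X) + (roughConv W A Z, Z.1) =
        convPair W A φ Z := Prod.ext rfl (zero_add _)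
    rw [e] at this
    exact this.mono (by nlinarith [mul_nonneg hC₁ hM, mul_nonneg hC₂ hm0])
  refine ⟨C₁ + C₂, by positivity, key, ?_⟩
  intro φ ψ Y Z m M M₁ M₂ hφ hψ hm hY hZ hYZ
  have e : convPair W A φ Y - convPair W A ψ Z = convPair W A (φ - ψ) (Y - Z) := by
    refine Prod.ext (funext fun t => ?_) rfl
    have h3 : roughConv W A (Y - Z) t = roughConv W A Y t - roughConv W A Z t := by
      have hs : shifted A t (Y - Z) = shifted A t Y - shifted A t Z := by
        refine Prod.ext (funext fun r => ?_) (funext fun r => ?_)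
        · simp [shifted]
        · simp [shifted]
      refine IsRoughIntegral.roughIntegral_eq unitInterval.nonneg' ?_
      rw [hs]
      exact ((h2 Y M₁ hY).1 t).sub ((h2 Z M₂ hZ).1 t)
    simp only [convPair, Prod.fst_sub, Pi.sub_apply, h3, driftConv_sub A hφ hψ]
    abel
  rw [e]
  exact key _ _ m M (hφ.sub hψ) hm hYZ

end Convolution

/-! ### Composition of controlled paths with smooth maps. -/

section Composition

variable {V X E : Type*}
  [NormedAddCommGroup V] [InnerProductSpace ℝ V]
  [NormedAddCommGroup X] [NormedSpace ℝ X] [NormedAddCommGroup E] [NormedSpace ℝ E]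
  {α : ℝ≥0}

/-- `G` is twice differentiable with Lipschitz second derivative, and vanishes to second order
at `0`. -/
structure CubicAtZero (G : X → E) (c : ℝ) : Prop where
  hasFDerivAt : ∀ x, HasFDerivAt G (fderiv ℝ G x) x
  hasFDerivAt_fderiv : ∀ x, HasFDerivAt (fderiv ℝ G) (fderiv ℝ (fderiv ℝ G) x) x
  symm : ∀ x u v, fderiv ℝ (fderiv ℝ G) x u v = fderiv ℝ (fderiv ℝ G) x v u
  nonneg : 0 ≤ c
  lip : ∀ x y, ‖fderiv ℝ (fderiv ℝ G) x - fderiv ℝ (fderiv ℝ G) y‖ ≤ c * ‖x - y‖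
  zero : G 0 = 0
  fderiv_zero : fderiv ℝ G 0 = 0
  fderiv_fderiv_zero : fderiv ℝ (fderiv ℝ G) 0 = 0

set_option maxSynthPendingDepth 3 in
lemma BoundedDerivs.exists_cubicAtZero {G : X → E} (hG : BoundedDerivs 3 G) (hG0 : G 0 = 0)
    (hG1 : fderiv ℝ G 0 = 0) (hG2 : fderiv ℝ (fderiv ℝ G) 0 = 0) : ∃ c, CubicAtZero G c := by
  obtain ⟨hd, hb⟩ := hG
  obtain ⟨c, hc⟩ := hb 3 (by norm_num) le_rfl
  have hd3 : ContDiff ℝ 3 G := by exact_mod_cast hd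
  have hd2 : ContDiff ℝ 2 (fderiv ℝ G) := hd3.fderiv_right (by norm_num)
  have hd1 : ContDiff ℝ 1 (fderiv ℝ (fderiv ℝ G)) := hd2.fderiv_right (by norm_num)
  have hc' : ∀ x, ‖fderiv ℝ (fderiv ℝ (fderiv ℝ G)) x‖ ≤ c := fun x => by
    rw [← norm_iteratedFDeriv_one, norm_iteratedFDeriv_fderiv, norm_iteratedFDeriv_fderiv]
    exact hc x
  refine ⟨c, ?_, ?_, ?_, (norm_nonneg _).trans (hc' 0), ?_, hG0, hG1, hG2⟩
  · exact fun x => (hd3.differentiable (by norm_num) x).hasFDerivAt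
  · exact fun x => (hd2.differentiable (by norm_num) x).hasFDerivAt
  · exact fun x u v => ((hd3.contDiffAt (x := x)).isSymmSndFDerivAt (by simp; norm_num)).eq u v
  · exact fun x y => convex_univ.norm_image_sub_le_of_norm_fderiv_le
      (fun z _ => hd1.differentiable (by norm_num) z) (fun z _ => hc' z)
      (Set.mem_univ y) (Set.mem_univ x)

namespace CubicAtZero

variable {G : X → E} {c : ℝ}

/-- Integrating the Lipschitz bound on D²G from 0 gives D²G = O(M) and then DG = O(M²) on the ball
of radius M, the source of the small factor. -/
lemma norm_fderiv_fderiv_le (h : CubicAtZero G c) {x : X} {M : ℝ} (hx : ‖x‖ ≤ M) :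
    ‖fderiv ℝ (fderiv ℝ G) x‖ ≤ c * M := by
  have := h.lip x 0
  rw [h.fderiv_fderiv_zero, sub_zero, sub_zero] at this
  exact this.trans (mul_le_mul_of_nonneg_left hx h.nonneg)

lemma norm_fderiv_sub_le (h : CubicAtZero G c) {x y : X} {M : ℝ} (hx : ‖x‖ ≤ M) (hy : ‖y‖ ≤ M) :
    ‖fderiv ℝ G x - fderiv ℝ G y‖ ≤ c * M * ‖x - y‖ :=
  (convex_closedBall (0 : X) M).norm_image_sub_le_of_norm_hasFDerivWithin_le
    (fun z _ => (h.hasFDerivAt_fderiv z).hasFDerivWithinAt)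
    (fun _ hz => h.norm_fderiv_fderiv_le (mem_closedBall_zero_iff.1 hz))
    (mem_closedBall_zero_iff.2 hy) (mem_closedBall_zero_iff.2 hx)

lemma norm_fderiv_le (h : CubicAtZero G c) {x : X} {M : ℝ} (hx : ‖x‖ ≤ M) :
    ‖fderiv ℝ G x‖ ≤ c * M * M := by
  have hM : 0 ≤ M := (norm_nonneg _).trans hx
  have := h.norm_fderiv_sub_le hx (y := 0) (by simpa using hM)
  rw [h.fderiv_zero, sub_zero, sub_zero] at this
  exact this.trans (mul_le_mul_of_nonneg_left hx (mul_nonneg h.nonneg hM))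

/-- The quadratic error turns α-Hölder increments into the order 2α needed for a remainder. -/
lemma norm_taylor_le (h : CubicAtZero G c) (x y : X) :
    ‖fderiv ℝ G x - fderiv ℝ G y - fderiv ℝ (fderiv ℝ G) y (x - y)‖ ≤
      c * ‖x - y‖ * ‖x - y‖ :=
  (convex_segment y x).norm_image_sub_le_of_norm_hasFDerivWithin_le'
    (fun z _ => (h.hasFDerivAt_fderiv z).hasFDerivWithinAt)
    (fun z hz => (h.lip z y).trans (mul_le_mul_of_nonneg_left
      (by
        rw [segment_eq_image'] at hz
        obtain ⟨θ, hθ, rfl⟩ := hz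
        rw [add_sub_cancel_left, norm_smul, Real.norm_eq_abs, abs_of_nonneg hθ.1]
        exact mul_le_of_le_one_left (norm_nonneg _) hθ.2) h.nonneg))
    (left_mem_segment ℝ y x) (right_mem_segment ℝ y x)

end CubicAtZero

/-- The derivative of `(G(Y), DG(Y)Y')` in the direction of the pair `H`. -/
def derivPair (G : X → E) (Y H : PathPair V X) : PathPair V E :=
  (fun t => fderiv ℝ G (Y.1 t) (H.1 t),
   fun t => (fderiv ℝ (fderiv ℝ G) (Y.1 t) (H.1 t)).comp (Y.2 t) +
     (fderiv ℝ G (Y.1 t)).comp (H.2 t))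

/-- The composition `(G(Y), DG(Y)Y')` for a map with values in an arbitrary space. -/
def composePair (G : X → E) (Y : PathPair V X) : PathPair V E :=
  (fun t => G (Y.1 t), fun t => (fderiv ℝ G (Y.1 t)).comp (Y.2 t))

lemma norm_comp_le_of_le {T : X →L[ℝ] E} {U : V →L[ℝ] X} {a b : ℝ} (hT : ‖T‖ ≤ a) (hU : ‖U‖ ≤ b) :
    ‖T.comp U‖ ≤ a * b :=
  (T.opNorm_comp_le U).trans
    (mul_le_mul hT hU (norm_nonneg _) ((norm_nonneg _).trans hT))

lemma norm_apply_le_of_le {T : X →L[ℝ] E} {x : X} {a b : ℝ} (hT : ‖T‖ ≤ a) (hx : ‖x‖ ≤ b) :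
    ‖T x‖ ≤ a * b :=
  T.le_of_opNorm_le_of_le hT hx

/-- Every term is linear in H and quadratic in the size of Y: each derivative of G costs one power
of M, which is returned by a factor Y' or an increment or remainder of Y. -/
lemma CubicAtZero.ctrlBound_derivPair {G : X → E} {c : ℝ} (h : CubicAtZero G c) {W : I → V}
    {w : ℝ} (hw0 : 0 ≤ w) (hw : ∀ s t : I, ‖W t - W s‖ ≤ w * |(t : ℝ) - s| ^ (α : ℝ))
    {Y H : PathPair V X} {M m : ℝ} (hY : CtrlBound α W Y M) (hH : CtrlBound α W H m) :
    CtrlBound α W (derivPair G Y H) (5 * (1 + w) ^ 2 * c * M ^ 2 * m) := by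
  have hM := hY.nonneg
  have hm := hH.nonneg
  have hc := h.nonneg
  set a := 1 + w with ha
  have ha1 : 1 ≤ a := by linarith
  have ha2 : a ≤ a ^ 2 := by nlinarith
  have hcM : 0 ≤ c * M ^ 2 * m := by positivity
  have hY1 := fun s t => hY.path_holder hw s t
  have hH1 := fun s t => hH.path_holder hw s t
  rw [← ha] at hY1 hH1
  constructor
  · intro t
    refine (norm_apply_le_of_le (h.norm_fderiv_le (hY.path t)) (hH.path t)).trans ?_
    nlinarith
  · intro t
    refine (norm_add_le_of_le
      (norm_comp_le_of_le (norm_apply_le_of_le (h.norm_fderiv_fderiv_le (hY.path t)) (hH.path t))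
        (hY.deriv t))
      (norm_comp_le_of_le (h.norm_fderiv_le (hY.path t)) (hH.deriv t))).trans ?_
    nlinarith
  · intro s t
    set x := |(t : ℝ) - s| ^ (α : ℝ)
    have hx : 0 ≤ x := Real.rpow_nonneg (abs_nonneg _) _
    have e : (derivPair G Y H).2 t - (derivPair G Y H).2 s =
        ((fderiv ℝ (fderiv ℝ G) (Y.1 t) - fderiv ℝ (fderiv ℝ G) (Y.1 s)) (H.1 t)).comp (Y.2 t) +
        (fderiv ℝ (fderiv ℝ G) (Y.1 s) (H.1 t - H.1 s)).comp (Y.2 t) +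
        (fderiv ℝ (fderiv ℝ G) (Y.1 s) (H.1 s)).comp (Y.2 t - Y.2 s) +
        (fderiv ℝ G (Y.1 t) - fderiv ℝ G (Y.1 s)).comp (H.2 t) +
        (fderiv ℝ G (Y.1 s)).comp (H.2 t - H.2 s) := by
      simp only [derivPair, sub_apply, map_sub, ContinuousLinearMap.sub_comp,
        ContinuousLinearMap.comp_sub]
      abel
    have b1 := norm_comp_le_of_le (norm_apply_le_of_le ((h.lip (Y.1 t) (Y.1 s)).trans
      (mul_le_mul_of_nonneg_left (hY1 s t) hc)) (hH.path t)) (hY.deriv t)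
    have b2 := norm_comp_le_of_le (norm_apply_le_of_le (h.norm_fderiv_fderiv_le (hY.path s))
      (hH1 s t)) (hY.deriv t)
    have b3 := norm_comp_le_of_le (norm_apply_le_of_le (h.norm_fderiv_fderiv_le (hY.path s))
      (hH.path s)) (hY.deriv_holder s t)
    have b4 := norm_comp_le_of_le ((h.norm_fderiv_sub_le (hY.path t) (hY.path s)).trans
      (mul_le_mul_of_nonneg_left (hY1 s t) (by positivity))) (hH.deriv t)
    have b5 := norm_comp_le_of_le (h.norm_fderiv_le (hY.path s)) (hH.deriv_holder s t)
    rw [e]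
    refine (norm_add_le_of_le (norm_add_le_of_le (norm_add_le_of_le (norm_add_le_of_le b1 b2) b3)
      b4) b5).trans ?_
    have hz : 0 ≤ c * M ^ 2 * m * x := by positivity
    calc _ = (3 * a + 2) * (c * M ^ 2 * m * x) := by ring
      _ ≤ (5 * a ^ 2) * (c * M ^ 2 * m * x) := by gcongr; linarith
      _ = _ := by ring
  · intro s t
    set x := |(t : ℝ) - s| ^ (α : ℝ)
    have hx : 0 ≤ x := Real.rpow_nonneg (abs_nonneg _) _
    have hxx : |(t : ℝ) - s| ^ (2 * (α : ℝ)) = x * x := by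
      rw [← Real.rpow_add_of_nonneg (abs_nonneg _) α.coe_nonneg α.coe_nonneg, two_mul]
    -- Symmetry of D²G identifies D²G(Y_s)(H_s)(Y'_s W_{s,t}) with the term in which Y'_s W_{s,t} is
    -- the first argument, as the Taylor expansion of DG produces it.
    have e : remainder W (derivPair G Y H) s t =
        (fderiv ℝ G (Y.1 t) - fderiv ℝ G (Y.1 s)) (H.1 t - H.1 s) +
        (fderiv ℝ G (Y.1 t) - fderiv ℝ G (Y.1 s) -
          fderiv ℝ (fderiv ℝ G) (Y.1 s) (Y.1 t - Y.1 s)) (H.1 s) +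
        fderiv ℝ (fderiv ℝ G) (Y.1 s) (remainder W Y s t) (H.1 s) +
        fderiv ℝ G (Y.1 s) (remainder W H s t) := by
      simp only [remainder, derivPair, sub_apply, add_apply, map_sub,
        ContinuousLinearMap.comp_apply, h.symm (Y.1 s) (H.1 s)]
      abel
    have b1 := norm_apply_le_of_le ((h.norm_fderiv_sub_le (hY.path t) (hY.path s)).trans
      (mul_le_mul_of_nonneg_left (hY1 s t) (by positivity))) (hH1 s t)
    have b2 := norm_apply_le_of_le ((h.norm_taylor_le (Y.1 t) (Y.1 s)).trans
      (mul_le_mul (mul_le_mul_of_nonneg_left (hY1 s t) hc) (hY1 s t) (norm_nonneg _)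
        (by positivity))) (hH.path s)
    have b3 := norm_apply_le_of_le (norm_apply_le_of_le (h.norm_fderiv_fderiv_le (hY.path s))
      (hY.rem s t)) (hH.path s)
    have b4 := norm_apply_le_of_le (h.norm_fderiv_le (hY.path s)) (hH.rem s t)
    rw [e]
    refine (norm_add_le_of_le (norm_add_le_of_le (norm_add_le_of_le b1 b2) b3) b4).trans ?_
    rw [hxx]
    have hz : 0 ≤ c * M ^ 2 * m * (x * x) := by positivity
    calc _ = (2 * a ^ 2 + 2) * (c * M ^ 2 * m * (x * x)) := by ring
      _ ≤ (5 * a ^ 2) * (c * M ^ 2 * m * (x * x)) := by gcongr; linarith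
      _ = _ := by ring

/-- Mean value inequality for controlled paths. -/
lemma CtrlBound.sub_of_hasDerivAt {W : I → V} {c c' : ℝ → PathPair V E} {B : ℝ}
    (h1 : ∀ θ t, HasDerivAt (fun θ => (c θ).1 t) ((c' θ).1 t) θ)
    (h2 : ∀ θ t, HasDerivAt (fun θ => (c θ).2 t) ((c' θ).2 t) θ)
    (hB : ∀ θ ∈ Set.Ico (0 : ℝ) 1, CtrlBound α W (c' θ) B) : CtrlBound α W (c 1 - c 0) B where
  path t := norm_image_sub_le_of_norm_deriv_le_segment_01'
    (fun θ _ => (h1 θ t).hasDerivWithinAt) fun θ hθ => (hB θ hθ).path t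
  deriv t := norm_image_sub_le_of_norm_deriv_le_segment_01'
    (fun θ _ => (h2 θ t).hasDerivWithinAt) fun θ hθ => (hB θ hθ).deriv t
  deriv_holder s t := by
    have e : (c 1 - c 0).2 t - (c 1 - c 0).2 s =
        ((c 1).2 t - (c 1).2 s) - ((c 0).2 t - (c 0).2 s) := by
      simp only [Prod.snd_sub, Pi.sub_apply]
      abel
    rw [e]
    exact norm_image_sub_le_of_norm_deriv_le_segment_01' (f := fun θ => (c θ).2 t - (c θ).2 s)
      (f' := fun θ => (c' θ).2 t - (c' θ).2 s)
      (fun θ _ => ((h2 θ t).sub (h2 θ s)).hasDerivWithinAt) fun θ hθ => (hB θ hθ).deriv_holder s t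
  rem s t := by
    rw [remainder_sub]
    exact norm_image_sub_le_of_norm_deriv_le_segment_01' (f := fun θ => remainder W (c θ) s t)
      (f' := fun θ => remainder W (c' θ) s t)
      (fun θ _ => (((h1 θ t).sub (h1 θ s)).sub
        ((h2 θ s).clm_apply (hasDerivAt_const θ (W t - W s)) |>.congr_deriv
          (by simp))).hasDerivWithinAt) fun θ hθ => (hB θ hθ).rem s t

/-- Along the segment from Z to Y the derivative of the composition is `derivPair`, and by convexity
the bound M persists; the mean value inequality then replaces any direct estimate of second
differences. -/
lemma CubicAtZero.ctrlBound_composePair_sub {G : X → E} {c : ℝ} (h : CubicAtZero G c) {W : I → V}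
    {w : ℝ} (hw0 : 0 ≤ w) (hw : ∀ s t : I, ‖W t - W s‖ ≤ w * |(t : ℝ) - s| ^ (α : ℝ))
    {Y Z : PathPair V X} {M m : ℝ} (hY : CtrlBound α W Y M) (hZ : CtrlBound α W Z M)
    (hYZ : CtrlBound α W (Y - Z) m) :
    CtrlBound α W (composePair G Y - composePair G Z) (5 * (1 + w) ^ 2 * c * M ^ 2 * m) := by
  have hline : ∀ t (θ : ℝ), HasDerivAt (fun θ : ℝ => (Z + θ • (Y - Z)).1 t) ((Y - Z).1 t) θ :=
    fun t θ => by
      simpa using ((hasDerivAt_id θ).smul_const ((Y - Z).1 t)).const_add (Z.1 t)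
  have hline' : ∀ t (θ : ℝ), HasDerivAt (fun θ : ℝ => (Z + θ • (Y - Z)).2 t) ((Y - Z).2 t) θ :=
    fun t θ => by
      simpa using ((hasDerivAt_id θ).smul_const ((Y - Z).2 t)).const_add (Z.2 t)
  have := CtrlBound.sub_of_hasDerivAt (α := α) (W := W)
    (c := fun θ : ℝ => composePair G (Z + θ • (Y - Z)))
    (c' := fun θ : ℝ => derivPair G (Z + θ • (Y - Z)) (Y - Z))
    (B := 5 * (1 + w) ^ 2 * c * M ^ 2 * m)
    (fun θ t => (h.hasFDerivAt _).comp_hasDerivAt θ (hline t θ))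
    (fun θ t => ((h.hasFDerivAt_fderiv _).comp_hasDerivAt θ (hline t θ)).clm_comp (hline' t θ))
    (fun θ hθ => by
      refine h.ctrlBound_derivPair hw0 hw ?_ hYZ
      have e : Z + θ • (Y - Z) = (1 - θ) • Z + θ • Y := by
        rw [sub_smul, smul_sub, one_smul]; abel
      rw [e]
      have := (hZ.smul (1 - θ)).add (hY.smul θ)
      rw [abs_of_nonneg hθ.1, abs_of_nonneg (by linarith [hθ.2])] at this
      exact this.mono (le_of_eq (by ring)))
  simpa using this

lemma CubicAtZero.ctrlBound_composePair {G : X → E} {c : ℝ} (h : CubicAtZero G c) {W : I → V}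
    {w : ℝ} (hw0 : 0 ≤ w) (hw : ∀ s t : I, ‖W t - W s‖ ≤ w * |(t : ℝ) - s| ^ (α : ℝ))
    {Y : PathPair V X} {M : ℝ} (hY : CtrlBound α W Y M) :
    CtrlBound α W (composePair G Y) (5 * (1 + w) ^ 2 * c * M ^ 2 * M) := by
  have h0 : CtrlBound α W (0 : PathPair V X) M := by
    simpa using (hY.smul 0).mono (by simpa using hY.nonneg)
  have := h.ctrlBound_composePair_sub hw0 hw hY h0 (by simpa using hY)
  have e : composePair G (0 : PathPair V X) = 0 :=
    Prod.ext (funext fun t => h.zero) (funext fun t => by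
      change (fderiv ℝ G 0).comp (0 : V →L[ℝ] X) = 0
      exact ContinuousLinearMap.comp_zero _)
  rwa [e, sub_zero] at this

/-- A `C¹` map with vanishing derivative at `0` is Lipschitz near `0` with a small constant. -/
lemma exists_lipschitz_near_zero {F : X → E} (hF : ContDiff ℝ 1 F) (hF1 : fderiv ℝ F 0 = 0)
    {ε : ℝ} (hε : 0 < ε) :
    ∃ ρ : ℝ, 0 < ρ ∧ ∀ x y, ‖x‖ ≤ ρ → ‖y‖ ≤ ρ → ‖F x - F y‖ ≤ ε * ‖x - y‖ := by
  have hc : Continuous (fderiv ℝ F) := hF.continuous_fderiv (by norm_num)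
  obtain ⟨δ, hδ, H⟩ := Metric.continuousAt_iff.1 hc.continuousAt ε hε
  refine ⟨δ / 2, half_pos hδ, fun x y hx hy => ?_⟩
  refine (convex_closedBall (0 : X) (δ / 2)).norm_image_sub_le_of_norm_fderiv_le
    (fun z _ => hF.differentiable (by norm_num) z) (fun z hz => ?_)
    (mem_closedBall_zero_iff.2 hy) (mem_closedBall_zero_iff.2 hx)
  have := H (x := z) (lt_of_le_of_lt hz (half_lt_self hδ))
  rw [hF1, dist_zero_right] at this
  exact this.le

end Composition

/-! ### Invariance and contraction of the mild map. -/

section MildMap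

variable {V X : Type*}
  [NormedAddCommGroup V] [InnerProductSpace ℝ V]
  [NormedAddCommGroup X] [NormedSpace ℝ X]
  {α : ℝ≥0}

lemma continuous_of_mem_controlled (hα : 0 < α) {W : I → V} {Y : PathPair V X}
    (hY : Y ∈ controlled α W) : Continuous Y.1 :=
  hY.1.holderWith.continuous hα

/-- S(·)ξ is Lipschitz in time, hence controlled with zero derivative. -/
lemma initialPair_mem_controlled [CompleteSpace X] (hα' : (α : ℝ) ≤ 1 / 2) {W : I → V} {w : ℝ}
    (hw : ∀ s t : I, ‖W t - W s‖ ≤ w * |(t : ℝ) - s| ^ (α : ℝ)) (A : X →L[ℝ] X) (ξ : X) :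
    initialPair A ξ ∈ controlled α W := by
  obtain ⟨S, hS0, hS1, hS2⟩ := exists_sg_bound A
  have hmem : ∀ r : I, (r : ℝ) ∈ Set.Icc (-1 : ℝ) 1 := fun r =>
    ⟨by linarith [r.2.1], r.2.2⟩
  have hconst : CtrlBound α W ((fun _ => ξ, 0) : PathPair V X) ‖ξ‖ := by
    constructor
    · exact fun t => le_rfl
    · exact fun t => by simp
    · intro s t
      simp only [Pi.zero_apply, sub_zero, norm_zero]
      positivity
    · intro s t
      simp only [remainder, sub_self, Pi.zero_apply, zero_apply, norm_zero]
      positivity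
  have := hconst.mulPair hα' (Φ := fun t : I => sg A t) (fun t => hS1 _ (hmem t))
    (fun s t => hS2 _ (hmem s) _ (hmem t))
  have e : mulPair (fun t : I => sg A t) ((fun _ => ξ, 0) : PathPair V X) = initialPair A ξ :=
    Prod.ext rfl (funext fun t => ContinuousLinearMap.comp_zero _)
  rw [e] at this
  exact this.mem_controlled hw

variable [FiniteDimensional ℝ V] [FiniteDimensional ℝ X]

/-- Existence of all the integrals, and invariance of the space of controlled paths. -/
theorem mildMap_wellDefined (hα : (1 / 3 : ℝ) < α) (hα' : (α : ℝ) ≤ 1 / 2) (W : RoughPath α V)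
    (A : X →L[ℝ] X) {F : X → X} (hF : Continuous F) {G : X → V →L[ℝ] X} {c : ℝ}
    (hG : CubicAtZero G c) {a : ℝ} {N : PathPair V X → ℝ} (hN : IsCtrlNorm α W.path a N)
    (f : ℝ → ℝ) (R : ℝ) {Y : PathPair V X} (hY : Y ∈ controlled α W.path) :
    (∀ t : I, IntervalIntegrable (driftIntegrand A F (cutoff N f R Y).1 t)
      MeasureTheory.volume 0 t) ∧
    (∀ t : I, shifted A t (compose G (cutoff N f R Y)) ∈ controlled α W.path ∧
      ∃ J : X, IsRoughIntegral W (shifted A t (compose G (cutoff N f R Y))) 0 t J) ∧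
    mildMap W A F G N f R Y ∈ controlled α W.path := by
  have : CompleteSpace X := FiniteDimensional.complete ℝ X
  have hα0 : 0 < α := by
    have : (0 : ℝ) < α := by linarith
    exact_mod_cast this
  obtain ⟨w, _, hw0, _, hw, _⟩ := W.exists_bounds
  have hχ := cutoff_mem (N := N) f R hY
  have hφ : Continuous fun t => F ((cutoff N f R Y).1 t) :=
    hF.comp (continuous_of_mem_controlled hα0 hχ)
  obtain ⟨m, hm⟩ := isCompact_univ.exists_bound_of_continuousOn hφ.continuousOn
  have hZ := hG.ctrlBound_composePair hw0 hw (hN.bound _ hχ)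
  obtain ⟨C₁, _, h1⟩ := exists_shifted_bound (V := V) hα' A
  obtain ⟨C₂, _, h2⟩ := exists_roughConv_bound hα hα' W A
  obtain ⟨C₃, _, h3, _⟩ := exists_convPair_bound hα hα' W A
  refine ⟨fun t => (continuous_driftIntegrand A hφ t).intervalIntegrable _ _,
    fun t => ⟨(h1 _ _ _ t hZ).mem_controlled hw, _, (h2 _ _ hZ).1 t⟩, ?_⟩
  rw [mildMap_eq_convPair]
  exact (h3 _ _ m _ hφ (fun t => hm t (Set.mem_univ t)) hZ).mem_controlled hw

/-- The truncated mild map is a contraction if the radius is small. -/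
theorem exists_mildMap_contraction (hα : (1 / 3 : ℝ) < α) (hα' : (α : ℝ) ≤ 1 / 2)
    (W : RoughPath α V) (A : X →L[ℝ] X) {F : X → X} (hF : ContDiff ℝ 1 F)
    (hF1 : fderiv ℝ F 0 = 0) {G : X → V →L[ℝ] X} {c : ℝ} (hG : CubicAtZero G c) {a : ℝ}
    {N : PathPair V X → ℝ} (hN : IsCtrlNorm α W.path a N) {f : ℝ → ℝ} (hf : IsCutoff f) :
    ∃ R₀ : ℝ, 0 < R₀ ∧ ∀ R : ℝ, 0 < R → R ≤ R₀ →
      ∀ Y ∈ controlled α W.path, ∀ Z ∈ controlled α W.path,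
        N (mildMap W A F G N f R Y - mildMap W A F G N f R Z) ≤ 1 / 2 * N (Y - Z) := by
  have : CompleteSpace X := FiniteDimensional.complete ℝ X
  have hα0 : 0 < α := by
    have : (0 : ℝ) < α := by linarith
    exact_mod_cast this
  obtain ⟨w, _, hw0, _, hw, _⟩ := W.exists_bounds
  obtain ⟨C, hC, -, h3⟩ := exists_convPair_bound hα hα' W A
  obtain ⟨L, hL0, hL⟩ := hf.exists_lipschitz
  have ha := hN.pos
  have hc := hG.nonneg
  -- Q gathers the linear costs: 4 for returning to N, C for the convolution, a(L + 1) for the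
  -- cut-off. P R² is the Lipschitz constant of composition with `G` at pointwise size aR.
  set Q := 4 * C * (a * (L + 1)) with hQ
  have hQ0 : 0 ≤ Q := by positivity
  set P := 5 * (1 + w) ^ 2 * c * a ^ 2 with hP
  have hP0 : 0 ≤ P := by positivity
  obtain ⟨ρ, hρ, hFρ⟩ := exists_lipschitz_near_zero hF hF1 (ε := 1 / (4 * (Q + 1)))
    (by positivity)
  have hε : Q * (1 / (4 * (Q + 1))) ≤ 1 / 4 := by
    rw [mul_one_div, div_le_div_iff₀ (by positivity) (by norm_num)]
    linarith
  set ε := 1 / (4 * (Q + 1))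
  -- The first bound keeps truncated paths where `F` has Lipschitz constant ε; the second gives R ≤
  -- 1 and QPR² ≤ QPR ≤ 1/4. Drift and rough part then contribute 1/4 each.
  refine ⟨min (ρ / a) (1 / (1 + 4 * (Q * P))), lt_min (by positivity) (by positivity),
    fun R hR hRle Y hY Z hZ => ?_⟩
  have hR1 : a * R ≤ ρ := by
    have := hRle.trans (min_le_left _ _)
    rw [le_div_iff₀ ha] at this
    linarith
  have hR2 : R * (1 + 4 * (Q * P)) ≤ 1 := by
    have := hRle.trans (min_le_right _ _)
    rwa [le_div_iff₀ (by positivity)] at this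
  have hQP := mul_nonneg hQ0 hP0
  have hR3 : R ≤ 1 := by nlinarith [mul_nonneg hR.le hQP]
  have hR4 : Q * P * R ^ 2 ≤ 1 / 4 := by nlinarith [mul_nonneg hR.le hQP]
  have hχY := cutoff_mem (N := N) f R hY
  have hχZ := cutoff_mem (N := N) f R hZ
  have bY := (hN.bound _ hχY).mono (mul_le_mul_of_nonneg_left (hN.cutoff_le hf hR hY) ha.le)
  have bZ := (hN.bound _ hχZ).mono (mul_le_mul_of_nonneg_left (hN.cutoff_le hf hR hZ) ha.le)
  have hlip := hN.cutoff_sub_le hf hL0 hL hR hY hZ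
  have bd := (hN.bound _ (sub_mem_controlled hχY hχZ)).mono (mul_le_mul_of_nonneg_left hlip ha.le)
  set n := N (Y - Z)
  have hn : 0 ≤ n := hN.nonneg (sub_mem_controlled hY hZ)
  have hdrift : ∀ t, ‖F ((cutoff N f R Y).1 t) - F ((cutoff N f R Z).1 t)‖ ≤
      ε * (a * ((L + 1) * n)) := fun t =>
    (hFρ _ _ ((bY.path t).trans hR1) ((bZ.path t).trans hR1)).trans
      (mul_le_mul_of_nonneg_left (bd.path t) (by positivity))
  have hcomp := hG.ctrlBound_composePair_sub hw0 hw bY bZ bd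
  have hfinal := h3 _ _ _ _ _ _ _ _
    (hF.continuous.comp (continuous_of_mem_controlled hα0 hχY))
    (hF.continuous.comp (continuous_of_mem_controlled hα0 hχZ)) hdrift
    (hG.ctrlBound_composePair hw0 hw bY) (hG.ctrlBound_composePair hw0 hw bZ) hcomp
  rw [mildMap_eq_convPair, mildMap_eq_convPair]
  refine (hN.le _ _ hfinal).trans ?_
  calc _ = (Q * ε + Q * P * R ^ 2) * n := by rw [hQ, hP]; ring
    _ ≤ 1 / 2 * n := by gcongr; linarith

end MildMap

end RoughCutoff

end

/-! ### The main theorem. -/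

theorem mainTheorem4
    {V X : Type*}
    [NormedAddCommGroup V] [InnerProductSpace ℝ V] [FiniteDimensional ℝ V]
    [NormedAddCommGroup X] [NormedSpace ℝ X] [FiniteDimensional ℝ X]
    (α : ℝ≥0) (hα : (1 / 3 : ℝ) < α) (hα' : (α : ℝ) ≤ 1 / 2)
    (W : RoughCutoff.RoughPath α V) (A : X →L[ℝ] X)
    (F : X → X) (hF : RoughCutoff.BoundedDerivs 1 F) (hF0 : F 0 = 0) (hF1 : fderiv ℝ F 0 = 0)
    (G : X → V →L[ℝ] X) (hG : RoughCutoff.BoundedDerivs 3 G) (hG0 : G 0 = 0)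
    (hG1 : fderiv ℝ G 0 = 0) (hG2 : fderiv ℝ (fderiv ℝ G) 0 = 0)
    (f : ℝ → ℝ) (hf : RoughCutoff.IsCutoff f)
    -- `N` is either of the two norms on controlled rough paths
    (N : RoughCutoff.PathPair V X → ℝ)
    (hN : N = RoughCutoff.crpNorm α W.path ∨ N = RoughCutoff.crpSupNorm α W.path) :
    -- for every `R > 0` all the integrals exist and `T_R` maps `D^{2α}_W` into itself
    (∀ R : ℝ, 0 < R → ∀ Y ∈ RoughCutoff.controlled (X := X) α W.path,
      (∀ t : I, IntervalIntegrable
        (RoughCutoff.driftIntegrand A F (RoughCutoff.cutoff N f R Y).1 t)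
        MeasureTheory.volume 0 t) ∧
      (∀ t : I,
        RoughCutoff.shifted A t (RoughCutoff.compose G (RoughCutoff.cutoff N f R Y)) ∈
          RoughCutoff.controlled (X := V →L[ℝ] X) α W.path ∧
        ∃ J : X, RoughCutoff.IsRoughIntegral W
          (RoughCutoff.shifted A t (RoughCutoff.compose G (RoughCutoff.cutoff N f R Y))) 0 t J) ∧
      RoughCutoff.mildMap W A F G N f R Y ∈ RoughCutoff.controlled (X := X) α W.path) ∧
    -- for every small `R` ...
    ∃ R₀ : ℝ, 0 < R₀ ∧ ∀ R : ℝ, 0 < R → R ≤ R₀ →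
      -- ... `T_R` is a contraction,
      (∃ K : ℝ, 0 ≤ K ∧ K < 1 ∧
        ∀ Y ∈ RoughCutoff.controlled (X := X) α W.path,
        ∀ Z ∈ RoughCutoff.controlled (X := X) α W.path,
          N (RoughCutoff.mildMap W A F G N f R Y - RoughCutoff.mildMap W A F G N f R Z)
            ≤ K * N (Y - Z)) ∧
      -- it has a unique fixed point,
      (∃! Y : RoughCutoff.PathPair V X,
        Y ∈ RoughCutoff.controlled α W.path ∧ RoughCutoff.mildMap W A F G N f R Y = Y) ∧
      -- and the truncated equation has a unique solution for every initial value
      (∀ ξ : X, ∃! U : RoughCutoff.PathPair V X,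
        U ∈ RoughCutoff.controlled α W.path ∧
        U = RoughCutoff.initialPair A ξ + RoughCutoff.mildMap W A F G N f R U) := by

  have : CompleteSpace X := FiniteDimensional.complete ℝ X
  have hα0 : 0 < α := by
    have : (0 : ℝ) < α := by linarith
    exact_mod_cast this
  obtain ⟨w, -, hw0, -, hw, -⟩ := W.exists_bounds
  have hN' : RoughCutoff.IsCtrlNorm α W.path (1 + w) N := by
    rcases hN with rfl | rfl
    · exact RoughCutoff.isCtrlNorm_crpNorm hα0 hw0 hw
    · exact RoughCutoff.isCtrlNorm_crpSupNorm hα0 hw0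
  have hFc : ContDiff ℝ 1 F := by exact_mod_cast hF.1
  obtain ⟨c, hc⟩ := hG.exists_cubicAtZero hG0 hG1 hG2
  have hwd := fun (R : ℝ) (Y : RoughCutoff.PathPair V X) (hY : Y ∈ RoughCutoff.controlled α W.path)
    => RoughCutoff.mildMap_wellDefined hα hα' W A hFc.continuous hc hN' f R hY
  refine ⟨fun R _ Y hY => hwd R Y hY, ?_⟩
  obtain ⟨R₀, hR₀, H⟩ := RoughCutoff.exists_mildMap_contraction hα hα' W A hFc hF1 hc hN' hf
  refine ⟨R₀, hR₀, fun R hR hRle => ⟨⟨1 / 2, by norm_num, by norm_num, H R hR hRle⟩, ?_,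
    fun ξ => ?_⟩⟩
  · exact hN'.existsUnique_fixedPoint hw _ (fun Y hY => (hwd R Y hY).2.2) (by norm_num)
      (by norm_num) (H R hR hRle)
  -- Adding the initial pair does not change differences, so the same contraction constant and the
  -- same R₀ serve every ξ.
  · obtain ⟨U, hU, hu⟩ := hN'.existsUnique_fixedPoint hw (K := 1 / 2)
      (fun U => RoughCutoff.initialPair A ξ + RoughCutoff.mildMap W A F G N f R U)
      (fun Y hY => RoughCutoff.add_mem_controlled
        (RoughCutoff.initialPair_mem_controlled hα' hw A ξ) (hwd R Y hY).2.2)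
      (by norm_num) (by norm_num) (fun Y hY Z hZ => by
        rw [add_sub_add_left_eq_sub]
        exact H R hR hRle Y hY Z hZ)
    exact ⟨U, ⟨hU.1, hU.2.symm⟩, fun U' h => hu U' ⟨h.1, h.2.symm⟩⟩
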